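/- Let $p$ be a prime number and let $\mathbb{C}_p$ be the completion of an algebraic closure of $\mathbb{Q}_p$, with its $p$-adic absolute value $|\cdot|$. Fix $\hat r\in|\mathbb{C}_p^*|$ with $\hat r>1$, and let $B=\{z\in\mathbb{C}_p:|z|\le\hat r\}$. Let $Q(z)=\sum_{i\ge0}a_iz^i$ be a power series with coefficients in $\mathbb{C}_p$ that converges on $B$ and satisfies $$\|Q\|=\sup_{i\ge0}|a_i|\,\hat r^{\,i}<p^{-1/(p-1)}.$$ For $\lambda\in\Lambda=\{\lambda\in\mathbb{C}_p:|\lambda-1|<1\}$ put $$P_\lambda(z)=\frac{\lambda}{p}z^p+\Bigl(1-\frac{\lambda}{p}\Bigr)z^{p+1},\qquad Q^*_\lambda=P_\lambda+Q:B\to\mathbb{C}_p,$$ and let $K(Q^*_\lambda,B)=\{z\in B:(Q^*_\lambda)^n(z)\in B\text{ for all }n\ge0\}$ be its filled Julia set. Then the set of $\lambda\in\Lambda$ with the following property is dense in $\Lambda$: there is a disc $D\subseteq K(Q^*_\lambda,B)$ (an open or closed ball with radius in $|\mathbb{C}_p^*|$) which is wandering, i.e. $(Q^*_\lambda)^n(D)\cap(Q^*_\lambda)^m(D)=\emptyset$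 for all $n\neq m$, $n,m\ge0$, and which is not attracted to an attracting cycle, i.e. no point of $D$ has an orbit under $Q^*_\lambda$ that converges to an attracting cycle of $Q^*_\lambda$ contained in $B$. (A cycle formed by the orbit of a point $z$ with $(Q^*_\lambda)^n(z)=z$, $n\ge1$, is attracting if $|((Q^*_\lambda)^n)'(z)|<1$.) -/

import Mathlib

open scoped PowerSeries

/-- The closed disc `{z : |z| ≤ r}` in `ℂ_p`, centred at the origin. -/
def closedDisc (p : ℕ) [Fact p.Prime] (r : ℝ) : Set ℂ_[p] :=
  {z | ‖z‖ ≤ r}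

/-- The parameter disc `Λ = {l : |l - 1| < 1}`. -/
def paramDisc (p : ℕ) [Fact p.Prime] : Set ℂ_[p] :=
  {l | ‖l - 1‖ < 1}

/-- `Q ∈ H(B)` for `B = {|z| ≤ r}`: the power series `Q` converges at every point of `B`. -/
def IsHolomorphicOnDisc (p : ℕ) [Fact p.Prime] (r : ℝ) (Q : ℂ_[p]⟦X⟧) : Prop :=
  ∀ z ∈ closedDisc p r, Summable fun n : ℕ => PowerSeries.coeff n Q * z ^ n

/-- The norm `‖Q‖_B = sup_i |a_i| r ^ i` of a power series `Q = ∑ a_i z ^ i`. -/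
noncomputable def discNorm (p : ℕ) [Fact p.Prime] (r : ℝ) (Q : ℂ_[p]⟦X⟧) : ℝ :=
  ⨆ i : ℕ, ‖PowerSeries.coeff i Q‖ * r ^ i

/-- The value at `z` of the holomorphic function with power series `Q`. -/
noncomputable def evalSeries (p : ℕ) [Fact p.Prime] (Q : ℂ_[p]⟦X⟧) (z : ℂ_[p]) : ℂ_[p] :=
  ∑' n : ℕ, PowerSeries.coeff n Q * z ^ n

/-- `P_l(z) = (l / p) z ^ p + (1 - l / p) z ^ (p + 1)`. -/
noncomputable def baseMap (p : ℕ) [Fact p.Prime] (l z : ℂ_[p]) : ℂ_[p] :=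
  l / (p : ℂ_[p]) * z ^ p + (1 - l / (p : ℂ_[p])) * z ^ (p + 1)

/-- `Q*_l = P_l + Q`. Only its values on the disc where `Q` converges are meaningful, and the
notions below only use orbits that stay in that disc. -/
noncomputable def perturbedMap (p : ℕ) [Fact p.Prime] (Q : ℂ_[p]⟦X⟧) (l z : ℂ_[p]) : ℂ_[p] :=
  baseMap p l z + evalSeries p Q z

/-- The filled Julia set `K(f, U)`: the points of `U` whose whole forward orbit stays in `U`. -/
def filledJulia {K : Type*} (f : K → K) (U : Set K) : Set K :=
  {z | ∀ n : ℕ, f^[n] z ∈ U}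

/-- A disc: an open or closed ball whose radius lies in the value group `|K^*|`. -/
def IsDisc {K : Type*} [NormedField K] (D : Set K) : Prop :=
  ∃ c u : K, u ≠ 0 ∧ (D = Metric.ball c ‖u‖ ∨ D = Metric.closedBall c ‖u‖)

/-- `E ⊆ U` is a wandering set of `f` if `f^n(E)` meets `f^m(E)` only when `n = m`. -/
def IsWandering {K : Type*} (f : K → K) (U E : Set K) : Prop :=
  E ⊆ U ∧ ∀ n m : ℕ, (f^[n] '' E ∩ f^[m] '' E).Nonempty → n = m

/-- `z` is a point of an attracting cycle of `f` in `U`, whose length divides `n ≥ 1`: the orbit of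
`z` stays in `U`, `f^n(z) = z`, and the multiplier `(f^n)'(z)` has absolute value `< 1`. (Which
period `n` is used does not matter: the multiplier for a multiple of the exact period is a power of
the multiplier for the exact period.) -/
def IsAttractingPeriodic {K : Type*} [NontriviallyNormedField K] (f : K → K) (U : Set K)
    (n : ℕ) (z : K) : Prop :=
  0 < n ∧ z ∈ filledJulia f U ∧ Function.IsPeriodicPt f n z ∧
    ∃ c : K, HasDerivAt f^[n] c z ∧ ‖c‖ < 1

/-- The orbit of `x` is attracted to the cycle of the point `z` of period `n`: the points
`f^{j + nk}(x)` converge to `z` as `k → ∞`, for some `j`. -/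
def IsAttractedTo {K : Type*} [TopologicalSpace K] (f : K → K) (n : ℕ) (z x : K) : Prop :=
  ∃ j : ℕ, Filter.Tendsto (fun k : ℕ => f^[j + n * k] x) Filter.atTop (nhds z)

/-- `D` is a wandering disc of `f` contained in the filled Julia set `K(f, U)`, which is not
attracted to an attracting cycle: no point of `D` is attracted to any attracting cycle. -/
def IsNonattractedWanderingDisc {K : Type*} [NontriviallyNormedField K] (f : K → K) (U D : Set K) :
    Prop :=
  IsDisc D ∧ D ⊆ filledJulia f U ∧ IsWandering f U D ∧
    ∀ (n : ℕ) (z : K), IsAttractingPeriodic f U n z → ∀ x ∈ D, ¬ IsAttractedTo f n z x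

/-! Two regimes of `f = Q*_λ` on the closed unit disc compete. In the residue disc of 1, `f`
multiplies distances exactly by `p` and has points that are nearly fixed. Along orbit segments in
the open unit disc that end at norm 1, `f` contracts small distances: by at least `k = p^(-1/p)` at
each step, except the one that arrives at norm 1. On such a segment a change of parameter by `σ`
moves the next value by `σ` times the norm of that value, hence by exactly `σ` on the arriving step.

The orbit to be built spends `N + 1` steps near 1, then `M + 1` steps in the open unit disc, then
returns near 1 for a longer stay, and so on. If `k ^ M` outweighs the expansion `p ^ (N + 1)`, then
on return all earlier dependence on the parameter is negligible against that of the last step, so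
the landing point moves isometrically with the parameter. This is the invariant carried by
`IsLanding`. The stay near 1 magnifies the parameter, so the exit point can be steered
(`IsLanding.exists_exit`), then the landing point can be steered towards the nearly fixed point
(`IsLanding.exists_return`), which gives the longer stay (`IsLanding.exists_next`). The successive
corrections decay geometrically, and the limit parameter has the whole infinite itinerary
(`exists_itinerary`).

The same balance of expansion and contraction makes a small disc around the starting point follow
the itinerary (`norm_iterate_sub_le_of_itinerary`). For every `d > 0` there are arbitrarily late
times at which the orbit is near 1 and, `d` steps later, in the open unit disc. This forces the disc
to wander and prevents convergence along any residue class of times, so no cycle at all attracts it.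

Equations are solved only approximately: over an algebraically closed field, a uniform limit of
polynomials with nonconstant norm on a ball comes arbitrarily close to zero
(`UniformlyPolynomial.exists_norm_lt`). This suffices because only nearness within a prescribed
positive distance is ever needed. -/

open Polynomial in
/-- `g` is a uniform limit of polynomials on `S`. -/
def UniformlyPolynomial {K : Type*} [NormedField K] (S : Set K) (g : K → K) : Prop :=
  ∀ ε > 0, ∃ P : K[X], ∀ x ∈ S, ‖g x - P.eval x‖ < ε

/-! ### Ultrametric inequalities and density of the value group -/

namespace Ultrametric

section

variable {K : Type*} [NormedField K] [IsUltrametricDist K]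

lemma norm_add_lt {x y : K} {c : ℝ} (hx : ‖x‖ < c) (hy : ‖y‖ < c) : ‖x + y‖ < c :=
  (IsUltrametricDist.norm_add_le_max x y).trans_lt (max_lt hx hy)

lemma norm_add_le' {x y : K} {c : ℝ} (hx : ‖x‖ ≤ c) (hy : ‖y‖ ≤ c) : ‖x + y‖ ≤ c :=
  (IsUltrametricDist.norm_add_le_max x y).trans (max_le hx hy)

lemma norm_sub_lt {x y : K} {c : ℝ} (hx : ‖x‖ < c) (hy : ‖y‖ < c) : ‖x - y‖ < c := by
  rw [sub_eq_add_neg]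
  exact norm_add_lt hx (by rwa [norm_neg])

lemma norm_sub_le' {x y : K} {c : ℝ} (hx : ‖x‖ ≤ c) (hy : ‖y‖ ≤ c) : ‖x - y‖ ≤ c := by
  rw [sub_eq_add_neg]
  exact norm_add_le' hx (by rwa [norm_neg])

lemma norm_sub_lt_trans {x y z : K} {c : ℝ} (h : ‖x - y‖ < c) (h' : ‖y - z‖ < c) :
    ‖x - z‖ < c := by
  have := norm_add_lt h h'
  rwa [sub_add_sub_cancel] at this

lemma norm_sub_le_trans {x y z : K} {c : ℝ} (h : ‖x - y‖ ≤ c) (h' : ‖y - z‖ ≤ c) :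
    ‖x - z‖ ≤ c := by
  have := norm_add_le' h h'
  rwa [sub_add_sub_cancel] at this

lemma norm_add_eq_left {x y : K} (h : ‖y‖ < ‖x‖) : ‖x + y‖ = ‖x‖ := by
  rw [IsUltrametricDist.norm_add_eq_max_of_norm_ne_norm h.ne', max_eq_left h.le]

lemma norm_eq_of_sub_lt {x y : K} (h : ‖x - y‖ < ‖y‖) : ‖x‖ = ‖y‖ := by
  have := norm_add_eq_left h
  rwa [add_sub_cancel] at this

lemma norm_sub_eq_of_lt {x y z : K} (h : ‖x - y‖ < ‖y - z‖) : ‖x - z‖ = ‖y - z‖ := by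
  have := norm_add_eq_left h
  rwa [add_comm, sub_add_sub_cancel] at this

lemma norm_eq_one_of_sub_one_lt {x : K} (h : ‖x - 1‖ < 1) : ‖x‖ = 1 := by
  simpa using norm_eq_of_sub_lt (y := (1 : K)) (by simpa using h)

lemma norm_pow_sub_pow_le {x y : K} {m : ℝ} (hx : ‖x‖ ≤ m) (hy : ‖y‖ ≤ m) (n : ℕ) :
    ‖x ^ (n + 1) - y ^ (n + 1)‖ ≤ m ^ n * ‖x - y‖ := by
  have hm : 0 ≤ m := (norm_nonneg x).trans hx
  induction n with
  | zero => simp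
  | succ n ih =>
    have : x ^ (n + 1 + 1) - y ^ (n + 1 + 1)
        = x ^ (n + 1) * (x - y) + (x ^ (n + 1) - y ^ (n + 1)) * y := by ring
    rw [this]
    refine norm_add_le' ?_ ?_
    · rw [norm_mul, norm_pow]
      gcongr
    · rw [norm_mul]
      calc _ ≤ m ^ n * ‖x - y‖ * m := by gcongr
        _ = _ := by ring

/-- The `p`-th power of a sum: away from `h ^ p`, every term is divisible by `p`. -/
lemma add_pow_prime_sub {p : ℕ} (hp : p.Prime) {z h : K} {m : ℝ} (hz : ‖z‖ ≤ m)
    (hh : ‖h‖ ≤ m) :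
    ‖(z + h) ^ p - z ^ p - h ^ p‖ ≤ ‖(p : K)‖ * m ^ (p - 1) * ‖h‖ := by
  have hm : 0 ≤ m := (norm_nonneg z).trans hz
  rw [add_pow_prime_eq hp]
  have : z ^ p + h ^ p + p * z * h *
        ∑ k ∈ Finset.Ioo 0 p, z ^ (k - 1) * h ^ (p - k - 1) * ((p.choose k / p : ℕ) : K)
        - z ^ p - h ^ p = p * h *
        ∑ k ∈ Finset.Ioo 0 p, z * (z ^ (k - 1) * h ^ (p - k - 1) * ((p.choose k / p : ℕ) : K)) := by
    rw [← Finset.mul_sum]; ring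
  rw [this, norm_mul, norm_mul, mul_right_comm]
  gcongr
  refine IsUltrametricDist.norm_sum_le_of_forall_le_of_nonneg (by positivity) fun k hk => ?_
  obtain ⟨h0, h1⟩ := Finset.mem_Ioo.1 hk
  have hc : ‖((p.choose k / p : ℕ) : K)‖ ≤ 1 := IsUltrametricDist.norm_natCast_le_one K _
  rw [norm_mul, norm_mul, norm_mul, norm_pow, norm_pow]
  calc ‖z‖ * (‖z‖ ^ (k - 1) * ‖h‖ ^ (p - k - 1) * ‖((p.choose k / p : ℕ) : K)‖)
      ≤ m * (m ^ (k - 1) * m ^ (p - k - 1) * 1) := by gcongr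
    _ = m ^ (p - 1) := by
      rw [mul_one, ← pow_add, ← pow_succ']
      congr 1
      omega

end

/-- High roots of an element of norm greater than 1 have norm as close to 1 as desired, and the
integer powers of such a root cannot jump over the interval. -/
lemma exists_lt_norm_lt_of_isAlgClosed {K : Type*} [NontriviallyNormedField K] [IsAlgClosed K]
    {a b : ℝ} (ha : 0 ≤ a) (hab : a < b) : ∃ x : K, a < ‖x‖ ∧ ‖x‖ < b := by
  wlog ha' : 0 < a generalizing a
  · obtain ⟨x, hx, hx'⟩ := this (a := b / 2) (by linarith) (by linarith) (by linarith)
    exact ⟨x, by linarith, hx'⟩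
  obtain ⟨c, hc⟩ := NormedField.exists_one_lt_norm K
  obtain ⟨n, hn⟩ := pow_unbounded_of_one_lt ‖c‖ ((one_lt_div ha').2 hab)
  have hn0 : n ≠ 0 := by
    rintro rfl
    simp only [pow_zero] at hn
    linarith
  obtain ⟨d, rfl⟩ := IsAlgClosed.exists_pow_nat_eq c (Nat.pos_of_ne_zero hn0)
  rw [norm_pow] at hc hn
  have hd1 : 1 < ‖d‖ := by
    by_contra h
    exact absurd hc (not_lt.2 (pow_le_one₀ (norm_nonneg _) (not_lt.1 h)))
  have hd2 : ‖d‖ < b / a := lt_of_pow_lt_pow_left₀ n (div_pos (ha'.trans hab) ha').le hn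
  obtain ⟨k, hk, hk'⟩ := exists_mem_Ico_zpow ha' hd1
  refine ⟨d ^ (k + 1), by rwa [norm_zpow], ?_⟩
  rw [norm_zpow, zpow_add_one₀ (by linarith)]
  rw [lt_div_iff₀ ha'] at hd2
  calc _ ≤ a * ‖d‖ := by gcongr
    _ < b := by rwa [mul_comm]

end Ultrametric

/-! ### Uniform limits of polynomials and their approximate zeros -/

namespace UniformlyPolynomial

open Ultrametric Polynomial

variable {K : Type*} [NormedField K]

lemma mono {S T : Set K} {g : K → K} (hg : UniformlyPolynomial T g) (h : S ⊆ T) :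
    UniformlyPolynomial S g := fun ε hε => (hg ε hε).imp fun _ hP x hx => hP x (h hx)

lemma congr {S : Set K} {g h : K → K} (hg : UniformlyPolynomial S g) (hgh : ∀ x ∈ S, g x = h x) :
    UniformlyPolynomial S h := fun ε hε => (hg ε hε).imp fun _ hP x hx => by
  rw [← hgh x hx]; exact hP x hx

lemma eval (S : Set K) (P : K[X]) : UniformlyPolynomial S fun x => P.eval x :=
  fun ε hε => ⟨P, fun x _ => by simpa using hε⟩

lemma const (S : Set K) (c : K) : UniformlyPolynomial S fun _ => c :=
  (eval S (C c)).congr (by simp)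

lemma id (S : Set K) : UniformlyPolynomial S fun x => x :=
  (eval S X).congr (by simp)

lemma const_mul {S : Set K} {g : K → K} (hg : UniformlyPolynomial S g) (c : K) :
    UniformlyPolynomial S fun x => c * g x := by
  intro ε hε
  rcases eq_or_ne c 0 with rfl | hc
  · exact ⟨0, by simpa using fun _ _ => hε⟩
  obtain ⟨P, hP⟩ := hg (ε / ‖c‖) (by positivity)
  refine ⟨C c * P, fun x hx => ?_⟩
  have := hP x hx
  rw [lt_div_iff₀' (by positivity)] at this
  simpa [← mul_sub] using this

variable [IsUltrametricDist K]

lemma add {S : Set K} {g h : K → K} (hg : UniformlyPolynomial S g) (hh : UniformlyPolynomial S h) :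
    UniformlyPolynomial S fun x => g x + h x := by
  intro ε hε
  obtain ⟨P, hP⟩ := hg ε hε
  obtain ⟨R, hR⟩ := hh ε hε
  refine ⟨P + R, fun x hx => ?_⟩
  rw [eval_add, add_sub_add_comm]
  exact norm_add_lt (hP x hx) (hR x hx)

lemma sub {S : Set K} {g h : K → K} (hg : UniformlyPolynomial S g) (hh : UniformlyPolynomial S h) :
    UniformlyPolynomial S fun x => g x - h x :=
  (hg.add (hh.const_mul (-1))).congr fun x _ => by ring

/-- An error of at most 1 cannot push a value out of the closed unit ball. The bound on the
approximant is what makes products and compositions work. -/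
lemma exists_approx_norm_le {S : Set K} {g : K → K} (hg : UniformlyPolynomial S g)
    (hg1 : ∀ x ∈ S, ‖g x‖ ≤ 1) {ε : ℝ} (hε : 0 < ε) :
    ∃ P : K[X], ∀ x ∈ S, ‖g x - P.eval x‖ < ε ∧ ‖P.eval x‖ ≤ 1 := by
  obtain ⟨P, hP⟩ := hg (min ε 1) (by positivity)
  refine ⟨P, fun x hx => ⟨(hP x hx).trans_le (min_le_left _ _), ?_⟩⟩
  have h1 := (hP x hx).le.trans (min_le_right _ _)
  have := norm_sub_le' (hg1 x hx) h1
  rwa [sub_sub_cancel] at this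

lemma mul {S : Set K} {g h : K → K} (hg : UniformlyPolynomial S g) (hh : UniformlyPolynomial S h)
    (hg1 : ∀ x ∈ S, ‖g x‖ ≤ 1) (hh1 : ∀ x ∈ S, ‖h x‖ ≤ 1) :
    UniformlyPolynomial S fun x => g x * h x := by
  intro ε hε
  obtain ⟨P, hP⟩ := hg.exists_approx_norm_le hg1 hε
  obtain ⟨R, hR⟩ := hh.exists_approx_norm_le hh1 hε
  refine ⟨P * R, fun x hx => ?_⟩
  have : g x * h x - (P * R).eval x
      = (g x - P.eval x) * h x + P.eval x * (h x - R.eval x) := by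
    rw [eval_mul]; ring
  rw [this]
  refine norm_add_lt ?_ ?_ <;> rw [norm_mul]
  · exact (mul_le_of_le_one_right (norm_nonneg _) (hh1 x hx)).trans_lt (hP x hx).1
  · exact (mul_le_of_le_one_left (norm_nonneg _) (hP x hx).2).trans_lt (hR x hx).1

lemma pow {S : Set K} {g : K → K} (hg : UniformlyPolynomial S g) (hg1 : ∀ x ∈ S, ‖g x‖ ≤ 1)
    (n : ℕ) : UniformlyPolynomial S fun x => g x ^ n := by
  induction n with
  | zero => simpa using const S 1
  | succ n ih =>
    refine (ih.mul hg (fun x hx => ?_) hg1).congr fun x _ => (pow_succ _ _).symm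
    rw [norm_pow]
    exact pow_le_one₀ (norm_nonneg _) (hg1 x hx)

lemma comp {S : Set K} {q g : K → K} (hq : UniformlyPolynomial (Metric.closedBall 0 1) q)
    (hq_lip : ∀ z w, ‖z‖ ≤ 1 → ‖w‖ ≤ 1 → ‖q z - q w‖ ≤ ‖z - w‖)
    (hg : UniformlyPolynomial S g) (hg1 : ∀ x ∈ S, ‖g x‖ ≤ 1) :
    UniformlyPolynomial S fun x => q (g x) := by
  intro ε hε
  obtain ⟨P, hP⟩ := hg.exists_approx_norm_le hg1 hε
  obtain ⟨R, hR⟩ := hq ε hε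
  refine ⟨R.comp P, fun x hx => ?_⟩
  rw [eval_comp]
  refine norm_sub_lt_trans ((hq_lip _ _ (hg1 x hx) (hP x hx).2).trans_lt (hP x hx).1) ?_
  exact hR _ (by simpa using (hP x hx).2)

/-- A polynomial without zeros in an open ball has constant norm there. -/
lemma norm_eval_eq_of_no_root [IsAlgClosed K] {P : K[X]} {c a b : K} {ρ : ℝ}
    (ha : ‖a - c‖ < ρ) (hb : ‖b - c‖ < ρ) (h : ∀ x, ‖x - c‖ < ρ → P.eval x ≠ 0) :
    ‖P.eval a‖ = ‖P.eval b‖ := by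
  have hsplit := IsAlgClosed.splits P
  -- A root outside the ball is equidistant from all points of the ball, so each linear factor has
  -- the same norm at `a` and at `b`.
  have key : ∀ x ∈ P.roots, ‖a - x‖ = ‖b - x‖ := by
    intro x hx
    have hx' : ρ ≤ ‖x - c‖ := by
      by_contra hlt
      exact h x (not_le.1 hlt) (mem_roots'.1 hx).2
    rw [norm_sub_rev a, norm_sub_rev b]
    have : ∀ y, ‖y - c‖ < ρ → ‖x - y‖ = ‖x - c‖ := fun y hy => by
      rw [norm_sub_rev x y, norm_sub_rev x c]
      exact norm_sub_eq_of_lt (by rw [norm_sub_rev c x]; linarith)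
    rw [this a ha, this b hb]
  rw [hsplit.eval_eq_prod_roots, hsplit.eval_eq_prod_roots, norm_mul, norm_mul]
  congr 1
  rw [← normHom_apply, ← normHom_apply, map_multiset_prod, map_multiset_prod, Multiset.map_map,
    Multiset.map_map]
  congr 1
  exact Multiset.map_congr rfl key

/-- A uniform limit of polynomials on an open ball whose norm is not constant takes values
arbitrarily close to zero. -/
lemma exists_norm_lt [IsAlgClosed K] {g : K → K} {c a b : K} {ρ : ℝ}
    (hg : UniformlyPolynomial (Metric.ball c ρ) g)
    (ha : ‖a - c‖ < ρ) (hb : ‖b - c‖ < ρ) (hab : ‖g a‖ < ‖g b‖) {ε : ℝ} (hε : 0 < ε) :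
    ∃ x, ‖x - c‖ < ρ ∧ ‖g x‖ < ε := by
  have hgb : 0 < ‖g b‖ := (norm_nonneg _).trans_lt hab
  -- An error below `ε` leaves `P` without zeros if `‖g‖ ≥ ε` on the ball; an error below `‖g b‖`
  -- preserves the strict inequality between the norms at `a` and `b`.
  obtain ⟨P, hP⟩ := hg (min ε ‖g b‖) (by positivity)
  simp only [mem_ball_iff_norm] at hP
  by_contra! hcon
  have hno : ∀ x, ‖x - c‖ < ρ → P.eval x ≠ 0 := by
    intro x hx h0
    have := (hP x hx).trans_le (min_le_left _ _)
    rw [h0, sub_zero] at this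
    exact absurd this (not_lt.2 (hcon x hx))
  have h1 := norm_eval_eq_of_no_root ha hb hno
  have h2 : ‖P.eval b‖ = ‖g b‖ := by
    apply norm_eq_of_sub_lt
    rw [norm_sub_rev]
    exact (hP b hb).trans_le (min_le_right _ _)
  have h3 : ‖P.eval a‖ < ‖g b‖ := by
    have := norm_sub_lt hab ((hP a ha).trans_le (min_le_right _ _))
    rwa [sub_sub_cancel] at this
  linarith

end UniformlyPolynomial

/-! ### The family of maps and its critical radii -/

/-- The map `z ↦ (l / p) z ^ p + (1 - l / p) z ^ (p + 1) + q z`. -/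
noncomputable def perturbedFamily {K : Type*} [Field K] (p : ℕ) (q : K → K) (l z : K) : K :=
  l / p * z ^ p + (1 - l / p) * z ^ (p + 1) + q z

/-- `q` is a small analytic perturbation on the closed unit ball: it is bounded by `δ`,
`δ`-Lipschitz and a uniform limit of polynomials, where `δ < s` and `s` is the radius
`p ^ (-1 / (p - 1))`; the auxiliary radius `k` is `p ^ (-1 / p)`. -/
structure IsSmallPerturbation {K : Type*} [NormedField K] (p : ℕ) (q : K → K) (δ s k : ℝ) :
    Prop where
  prime : p.Prime
  norm_p : ‖(p : K)‖ = (p : ℝ)⁻¹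
  s_pos : 0 < s
  s_eq : p * s ^ (p - 1) = 1
  k_pos : 0 < k
  k_eq : p * k ^ p = 1
  lt_s : δ < s
  norm_le : ∀ z, ‖z‖ ≤ 1 → ‖q z‖ ≤ δ
  lipschitz : ∀ z w, ‖z‖ ≤ 1 → ‖w‖ ≤ 1 → ‖q z - q w‖ ≤ δ * ‖z - w‖
  uniformlyPolynomial : UniformlyPolynomial (Metric.closedBall 0 1) q

namespace IsSmallPerturbation

open Ultrametric

section constants

variable {K : Type*} [NormedField K] {p : ℕ} {q : K → K} {δ s k : ℝ}
  (H : IsSmallPerturbation p q δ s k)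

include H

lemma one_lt_p : (1 : ℝ) < p := by exact_mod_cast H.prime.one_lt

lemma p_pos : (0 : ℝ) < p := by linarith [H.one_lt_p]

lemma p_ne_zero : (p : K) ≠ 0 := by
  rw [← norm_pos_iff, H.norm_p]
  exact inv_pos.2 H.p_pos

lemma delta_nonneg : 0 ≤ δ := (norm_nonneg _).trans (H.norm_le 0 (by simp))

lemma s_pow : s ^ (p - 1) = (p : ℝ)⁻¹ := eq_inv_of_mul_eq_one_right H.s_eq

lemma k_pow : k ^ p = (p : ℝ)⁻¹ := eq_inv_of_mul_eq_one_right H.k_eq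

lemma inv_p_lt_one : (p : ℝ)⁻¹ < 1 := inv_lt_one_of_one_lt₀ H.one_lt_p

lemma s_lt_one : s < 1 := by
  by_contra h
  have := one_le_pow₀ (not_lt.1 h) (n := p - 1)
  rw [H.s_pow] at this
  linarith [H.inv_p_lt_one]

lemma k_lt_one : k < 1 := by
  by_contra h
  have := one_le_pow₀ (not_lt.1 h) (n := p)
  rw [H.k_pow] at this
  linarith [H.inv_p_lt_one]

/-- The radius `s` is the positive fixed point of `m ↦ p * m ^ p`, the law by which norms evolve in
the open unit disc; above it norms increase. -/
lemma mul_s_pow : p * s ^ p = s := by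
  have : s ^ p = s ^ (p - 1) * s := by rw [← pow_succ, Nat.sub_add_cancel H.prime.one_le]
  rw [this, ← mul_assoc, H.s_eq, one_mul]

lemma s_lt_k : s < k := by
  refine lt_of_pow_lt_pow_left₀ p H.k_pos.le ?_
  refine lt_of_mul_lt_mul_left ?_ H.p_pos.le
  rw [H.mul_s_pow, H.k_eq]
  exact H.s_lt_one

lemma inv_p_le_s : (p : ℝ)⁻¹ ≤ s := by
  rw [← H.s_pow]
  refine pow_le_of_le_one H.s_pos.le H.s_lt_one.le ?_
  have := H.prime.two_le
  omega

lemma inv_p_lt_k : (p : ℝ)⁻¹ < k := H.inv_p_le_s.trans_lt H.s_lt_k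

lemma delta_lt_k : δ < k := H.lt_s.trans H.s_lt_k

lemma delta_lt_one : δ < 1 := H.lt_s.trans H.s_lt_one

lemma lt_mul_pow {m : ℝ} (hm : s < m) : m < p * m ^ p := by
  have hm0 : 0 < m := H.s_pos.trans hm
  have hp := H.p_pos
  have h : s ^ (p - 1) < m ^ (p - 1) :=
    pow_lt_pow_left₀ hm H.s_pos.le (by have := H.prime.two_le; omega)
  have h' : m ^ p = m ^ (p - 1) * m := by rw [← pow_succ, Nat.sub_add_cancel H.prime.one_le]
  rw [h', ← mul_assoc]
  refine lt_mul_of_one_lt_left hm0 ?_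
  rw [← H.s_eq]
  gcongr

lemma inv_p_pow_le_one (N : ℕ) : (p : ℝ)⁻¹ ^ N ≤ 1 :=
  pow_le_one₀ (inv_nonneg.2 H.p_pos.le) H.inv_p_lt_one.le

lemma p_pow_mul_inv_pow {j N : ℕ} (h : j ≤ N) : (p : ℝ) ^ j * (p : ℝ)⁻¹ ^ N ≤ 1 := by
  have hp := H.p_pos
  rw [inv_pow, ← div_eq_mul_inv, div_le_one (by positivity)]
  exact pow_le_pow_right₀ H.one_lt_p.le h

/-- Changing the parameter. -/
lemma norm_param_sub {l l' z : K} :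
    ‖perturbedFamily p q l z - perturbedFamily p q l' z‖ = p * ‖l - l'‖ * ‖z‖ ^ p * ‖1 - z‖ := by
  have : perturbedFamily p q l z - perturbedFamily p q l' z
      = (l - l') / p * z ^ p * (1 - z) := by
    rw [perturbedFamily, perturbedFamily]; ring
  rw [this, norm_mul, norm_mul, norm_div, H.norm_p, norm_pow, div_inv_eq_mul, mul_comm (p : ℝ)]

end constants

variable {K : Type*} [NormedField K] [IsUltrametricDist K] {p : ℕ} {q : K → K} {δ s k : ℝ}

/-! ### One-step estimates in the two regimes -/

section estimates

variable (H : IsSmallPerturbation p q δ s k)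

include H

lemma norm_div_p {l : K} (hl : ‖l - 1‖ < 1) : ‖l / p‖ = p := by
  rw [norm_div, H.norm_p, norm_eq_one_of_sub_one_lt hl, one_div, inv_inv]

lemma norm_one_sub_div_p {l : K} (hl : ‖l - 1‖ < 1) : ‖1 - l / p‖ = p := by
  rw [norm_sub_rev, sub_eq_add_neg, norm_add_eq_left, H.norm_div_p hl]
  rw [norm_neg, norm_one, H.norm_div_p hl]
  exact H.one_lt_p

/-- Points of the open unit disc whose image is not too small. -/
lemma norm_apply_eq {l z : K} (hl : ‖l - 1‖ < 1) (hz : ‖z‖ < 1)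
    (hfz : s < ‖perturbedFamily p q l z‖) :
    s < ‖z‖ ∧ ‖perturbedFamily p q l z‖ = p * ‖z‖ ^ p := by
  have hp := H.p_pos
  have h1 : ‖l / p * z ^ p‖ = p * ‖z‖ ^ p := by rw [norm_mul, norm_pow, H.norm_div_p hl]
  have h2 : ‖(1 - l / p) * z ^ (p + 1)‖ = p * ‖z‖ ^ (p + 1) := by
    rw [norm_mul, norm_pow, H.norm_one_sub_div_p hl]
  have h3 := H.norm_le z hz.le
  -- If `‖z‖ ≤ s`, both monomials and `q z` have norm at most `s`, against the hypothesis on the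
  -- image.
  have hs : s < ‖z‖ := by
    by_contra hle
    rw [not_lt] at hle
    have h4 : p * ‖z‖ ^ p ≤ s := by
      calc _ ≤ p * s ^ p := by gcongr
        _ = s := H.mul_s_pow
    have h5 : p * ‖z‖ ^ (p + 1) ≤ p * ‖z‖ ^ p :=
      mul_le_mul_of_nonneg_left (pow_le_pow_of_le_one (norm_nonneg _) hz.le (Nat.le_succ _)) hp.le
    refine absurd hfz (not_lt.2 ?_)
    exact norm_add_le' (norm_add_le' (h1.le.trans h4) (h2.le.trans (h5.trans h4)))
      (h3.trans H.lt_s.le)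
  refine ⟨hs, ?_⟩
  have hz0 : 0 < ‖z‖ := H.s_pos.trans hs
  have h4 : s < p * ‖z‖ ^ p := by
    calc s = p * s ^ p := H.mul_s_pow.symm
      _ < _ := by
        have := H.prime.ne_zero
        have := H.s_pos
        gcongr
  have h5 : ‖l / p * z ^ p + (1 - l / p) * z ^ (p + 1)‖ = p * ‖z‖ ^ p := by
    rw [norm_add_eq_left, h1]
    rw [h1, h2, pow_succ]
    have : ‖z‖ ^ p * ‖z‖ < ‖z‖ ^ p := mul_lt_of_lt_one_right (by positivity) hz
    gcongr
  rw [perturbedFamily, norm_add_eq_left, h5]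
  rw [h5]
  exact h3.trans_lt (H.lt_s.trans h4)

/-- The radius `k` is the one that `m ↦ p * m ^ p` sends to 1. -/
lemma norm_le_k_of {l z : K} (hl : ‖l - 1‖ < 1) (hz : ‖z‖ < 1)
    (hfz : s < ‖perturbedFamily p q l z‖) (hfz' : ‖perturbedFamily p q l z‖ ≤ 1) : ‖z‖ ≤ k := by
  rw [(H.norm_apply_eq hl hz hfz).2, ← H.k_eq] at hfz'
  exact le_of_pow_le_pow_left₀ H.prime.ne_zero H.k_pos.le (le_of_mul_le_mul_left hfz' H.p_pos)

/-- The difference of two values is dominated by the `p`-th power of the difference of the points,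
up to a linear error. -/
lemma norm_sub_sub_le {l z w : K} {m : ℝ} (hl : ‖l - 1‖ < 1) (hz : ‖z‖ ≤ m) (hw : ‖w‖ ≤ m)
    (hm : m ≤ 1) :
    ‖perturbedFamily p q l z - perturbedFamily p q l w - l / p * (z - w) ^ p‖
      ≤ max (m ^ (p - 1)) (max (p * m ^ p) δ) * ‖z - w‖ := by
  have hp := H.p_pos
  -- Expanding around `w`, the mixed binomial terms carry a factor `p` that cancels the denominator;
  -- only the pure power of `z - w` keeps it.
  have : perturbedFamily p q l z - perturbedFamily p q l w - l / p * (z - w) ^ p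
      = l / p * ((w + (z - w)) ^ p - w ^ p - (z - w) ^ p)
        + ((1 - l / p) * (z ^ (p + 1) - w ^ (p + 1)) + (q z - q w)) := by
    rw [perturbedFamily, perturbedFamily, add_sub_cancel]; ring
  rw [this]
  refine norm_add_le' ?_ (norm_add_le' ?_ ?_)
  · rw [norm_mul, H.norm_div_p hl]
    have := add_pow_prime_sub H.prime hw (norm_sub_le' hz hw)
    calc _ ≤ p * (‖(p : K)‖ * m ^ (p - 1) * ‖z - w‖) := by gcongr
      _ = m ^ (p - 1) * ‖z - w‖ := by rw [H.norm_p]; field_simp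
      _ ≤ _ := by gcongr; exact le_max_left _ _
  · rw [norm_mul, H.norm_one_sub_div_p hl]
    have := norm_pow_sub_pow_le hz hw p
    calc _ ≤ p * (m ^ p * ‖z - w‖) := by gcongr
      _ = p * m ^ p * ‖z - w‖ := by ring
      _ ≤ _ := by gcongr; exact (le_max_left _ _).trans (le_max_right _ _)
  · refine (H.lipschitz z w (hz.trans hm) (hw.trans hm)).trans ?_
    gcongr; exact (le_max_right _ _).trans (le_max_right _ _)

lemma norm_sub_le_mul {l z w : K} (hl : ‖l - 1‖ < 1) (hz : ‖z‖ ≤ 1) (hw : ‖w‖ ≤ 1) :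
    ‖perturbedFamily p q l z - perturbedFamily p q l w‖ ≤ p * ‖z - w‖ := by
  have h := H.norm_sub_sub_le hl hz hw le_rfl
  have h1 : max ((1 : ℝ) ^ (p - 1)) (max (p * 1 ^ p) δ) ≤ p := by
    simp only [one_pow, mul_one]
    exact max_le H.one_lt_p.le (max_le le_rfl (H.delta_lt_one.trans H.one_lt_p).le)
  have h2 : ‖l / p * (z - w) ^ p‖ ≤ p * ‖z - w‖ := by
    rw [norm_mul, H.norm_div_p hl, norm_pow]
    have := pow_le_of_le_one (norm_nonneg _) (norm_sub_le' hz hw) H.prime.ne_zero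
    have := H.p_pos
    gcongr
  have := norm_add_le' (h.trans (mul_le_mul_of_nonneg_right h1 (norm_nonneg _))) h2
  rwa [sub_add_cancel] at this

/-- Contraction of small distances near the origin. -/
lemma norm_sub_le_of_small {l z w : K} {m : ℝ} (hl : ‖l - 1‖ < 1) (hz : ‖z‖ ≤ m) (hw : ‖w‖ ≤ m)
    (hm : m ≤ k) (hzw : ‖z - w‖ ≤ (p : ℝ)⁻¹ ^ 2) :
    ‖perturbedFamily p q l z - perturbedFamily p q l w‖ ≤ max k (p * m ^ p) * ‖z - w‖ := by
  have hp := H.p_pos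
  have hm0 : 0 ≤ m := (norm_nonneg _).trans hz
  have hm1 : m ≤ 1 := hm.trans H.k_lt_one.le
  have h := H.norm_sub_sub_le hl hz hw hm1
  have hp1 : p - 1 ≠ 0 := by have := H.prime.two_le; omega
  have h1 : max (m ^ (p - 1)) (max (p * m ^ p) δ) ≤ max k (p * m ^ p) := by
    refine max_le ?_ (max_le (le_max_right _ _) (H.delta_lt_k.le.trans (le_max_left _ _)))
    exact ((pow_le_of_le_one hm0 hm1 hp1).trans hm).trans (le_max_left _ _)
  -- The threshold `p⁻¹ ^ 2` is dictated by `p = 2`, where `‖z - w‖ ^ (p - 1)` is the distance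
  -- itself and must absorb the factor `p` and still leave `p⁻¹`.
  have h2 : ‖l / p * (z - w) ^ p‖ ≤ max k (p * m ^ p) * ‖z - w‖ := by
    rw [norm_mul, H.norm_div_p hl, norm_pow]
    have h3 : ‖z - w‖ ≤ 1 := norm_sub_le' (hz.trans hm1) (hw.trans hm1)
    have h4 : ‖z - w‖ ^ (p - 1) ≤ (p : ℝ)⁻¹ ^ 2 :=
      (pow_le_of_le_one (norm_nonneg _) h3 hp1).trans hzw
    have h5 : ‖z - w‖ ^ p = ‖z - w‖ ^ (p - 1) * ‖z - w‖ := by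
      rw [← pow_succ, Nat.sub_add_cancel H.prime.one_le]
    rw [h5, ← mul_assoc]
    gcongr
    calc _ ≤ p * (p : ℝ)⁻¹ ^ 2 := by gcongr
      _ = (p : ℝ)⁻¹ := by field_simp
      _ ≤ k := H.inv_p_lt_k.le
      _ ≤ _ := le_max_left _ _
  have := norm_add_le' (h.trans (mul_le_mul_of_nonneg_right h1 (norm_nonneg _))) h2
  rwa [sub_add_cancel] at this

/-- Points in the same residue class around a point near the origin have images in the same
residue class, uniformly in the parameter. -/
lemma norm_sub_lt_norm {l l' z w : K} (hl : ‖l - 1‖ < 1) (hl' : ‖l' - 1‖ < 1) (hw : ‖w‖ < 1)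
    (hfw : s < ‖perturbedFamily p q l' w‖) (hzw : ‖z - w‖ < ‖w‖) :
    ‖perturbedFamily p q l z - perturbedFamily p q l' w‖ < ‖perturbedFamily p q l' w‖ := by
  have hp := H.p_pos
  obtain ⟨hsw, hfw'⟩ := H.norm_apply_eq hl' hw hfw
  have hw0 : 0 < ‖w‖ := H.s_pos.trans hsw
  have hz := norm_eq_of_sub_lt hzw
  have hm' := H.lt_mul_pow hsw
  have h1 : ‖perturbedFamily p q l z - perturbedFamily p q l w‖ < p * ‖w‖ ^ p := by
    have h := H.norm_sub_sub_le hl hz.le le_rfl hw.le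
    have h2 : ‖l / p * (z - w) ^ p‖ < p * ‖w‖ ^ p := by
      rw [norm_mul, H.norm_div_p hl, norm_pow]
      have := pow_lt_pow_left₀ hzw (norm_nonneg _) H.prime.ne_zero
      gcongr
    have h3 : max (‖w‖ ^ (p - 1)) (max (p * ‖w‖ ^ p) δ) * ‖z - w‖ < p * ‖w‖ ^ p := by
      rw [← lt_div_iff₀' (lt_max_of_lt_left (by positivity)), lt_div_iff₀'
        (lt_max_of_lt_left (by positivity)), max_mul_of_nonneg _ _ (norm_nonneg _),
        max_mul_of_nonneg _ _ (norm_nonneg _)]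
      refine max_lt ?_ (max_lt ?_ ?_)
      · calc _ < ‖w‖ ^ (p - 1) * ‖w‖ := by gcongr
          _ = ‖w‖ ^ p := by rw [← pow_succ, Nat.sub_add_cancel H.prime.one_le]
          _ ≤ _ := le_mul_of_one_le_left (by positivity) H.one_lt_p.le
      · exact mul_lt_of_lt_one_right (by positivity) (hzw.trans hw)
      · exact (mul_le_of_le_one_left (norm_nonneg _) H.delta_lt_one.le).trans_lt (hzw.trans hm')
    have := norm_add_lt (h.trans_lt h3) h2
    rwa [sub_add_cancel] at this
  rw [hfw']
  refine norm_sub_lt_trans h1 ?_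
  rw [H.norm_param_sub, norm_sub_rev 1 w]
  have h2 : ‖w - 1‖ ≤ 1 := norm_sub_le' hw.le (by simp)
  have h3 : ‖l - l'‖ < 1 := by
    rw [norm_sub_rev l' 1] at hl'
    exact norm_sub_lt_trans hl hl'
  calc _ ≤ p * ‖l - l'‖ * ‖w‖ ^ p * 1 := by gcongr
    _ = ‖l - l'‖ * (p * ‖w‖ ^ p) := by ring
    _ < _ := mul_lt_of_lt_one_left (by positivity) h3

/-- Large relative distances near the origin are raised to the `p`-th power. -/
lemma norm_sub_eq_pow {l l' z w : K} {τ : ℝ} (hl : ‖l - 1‖ < 1) (hl' : ‖l' - 1‖ < 1)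
    (hll' : ‖l - l'‖ ≤ k) (hw : ‖w‖ < 1) (hfw : s < ‖perturbedFamily p q l' w‖)
    (hfw1 : ‖perturbedFamily p q l' w‖ ≤ 1) (hτ0 : 0 ≤ τ) (hτ1 : τ < 1) (hτ : k < τ ^ p)
    (hzw : ‖z - w‖ = τ * ‖w‖) :
    ‖perturbedFamily p q l z - perturbedFamily p q l' w‖
      = τ ^ p * ‖perturbedFamily p q l' w‖ := by
  have hp := H.p_pos
  obtain ⟨hsw, hfw'⟩ := H.norm_apply_eq hl' hw hfw
  have hwk := H.norm_le_k_of hl' hw hfw hfw1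
  have hw0 : 0 < ‖w‖ := H.s_pos.trans hsw
  have hz : ‖z‖ = ‖w‖ := norm_eq_of_sub_lt (by
    rw [hzw]; exact mul_lt_of_lt_one_left hw0 hτ1)
  have hτp : τ ^ p = τ ^ (p - 1) * τ := by
    rw [← pow_succ, Nat.sub_add_cancel H.prime.one_le]
  have hτ' : 0 < τ := by
    rcases hτ0.eq_or_lt with h | h
    · rw [← h, zero_pow H.prime.ne_zero] at hτ
      exact absurd hτ (not_lt.2 H.k_pos.le)
    · exact h
  have hτk : k < τ ^ (p - 1) := hτ.trans (by
    rw [hτp]; exact mul_lt_of_lt_one_right (by positivity) hτ1)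
  have hwp : ‖w‖ ^ p = ‖w‖ ^ (p - 1) * ‖w‖ := by
    rw [← pow_succ, Nat.sub_add_cancel H.prime.one_le]
  have hm' := H.lt_mul_pow hsw
  have h2 : ‖l / p * (z - w) ^ p‖ = τ ^ p * (p * ‖w‖ ^ p) := by
    rw [norm_mul, H.norm_div_p hl, norm_pow, hzw, mul_pow]; ring
  have h1 : ‖perturbedFamily p q l z - perturbedFamily p q l w‖ = τ ^ p * (p * ‖w‖ ^ p) := by
    have h := H.norm_sub_sub_le hl hz.le le_rfl hw.le
    -- Each linear coefficient times `‖w‖` is at most `k * (p * ‖w‖ ^ p)`, and `k < τ ^ p` lets the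
    -- pure power win.
    have h3 : max (‖w‖ ^ (p - 1)) (max (p * ‖w‖ ^ p) δ) * ‖z - w‖ < τ ^ p * (p * ‖w‖ ^ p) := by
      rw [max_mul_of_nonneg _ _ (norm_nonneg _), max_mul_of_nonneg _ _ (norm_nonneg _), hzw]
      have e : ∀ c : ℝ, c < k * (p * ‖w‖ ^ p) → c * τ < τ ^ p * (p * ‖w‖ ^ p) := fun c hc => by
        rw [hτp]
        calc c * τ < k * (p * ‖w‖ ^ p) * τ := by gcongr
          _ ≤ τ ^ (p - 1) * (p * ‖w‖ ^ p) * τ := by gcongr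
          _ = _ := by ring
      refine max_lt ?_ (max_lt ?_ ?_)
      · have : ‖w‖ ^ (p - 1) * (τ * ‖w‖) = ‖w‖ ^ p * τ := by rw [hwp]; ring
        rw [this]
        refine e _ ?_
        rw [← mul_assoc]
        refine lt_mul_of_one_lt_left (by positivity) ?_
        have := H.inv_p_lt_k
        rwa [inv_lt_iff_one_lt_mul₀ hp] at this
      · rw [show p * ‖w‖ ^ p * (τ * ‖w‖) = (p * ‖w‖ ^ p) * ‖w‖ * τ by ring, hτp]
        calc (p * ‖w‖ ^ p) * ‖w‖ * τ < (p * ‖w‖ ^ p) * τ ^ (p - 1) * τ := by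
              have := hwk.trans_lt hτk
              gcongr
          _ = _ := by ring
      · rw [show δ * (τ * ‖w‖) = δ * ‖w‖ * τ by ring]
        refine e _ ?_
        have := H.delta_lt_k
        have := H.k_pos
        have := H.delta_nonneg
        gcongr
    rw [← sub_add_cancel (_ - _) (l / p * (z - w) ^ p), add_comm, norm_add_eq_left, h2]
    rw [h2]
    exact h.trans_lt h3
  rw [hfw', ← h1, ← sub_add_sub_cancel _ (perturbedFamily p q l w), norm_add_eq_left]
  rw [h1, H.norm_param_sub, norm_sub_rev 1 w]
  have h2 : ‖w - 1‖ ≤ 1 := norm_sub_le' hw.le (by simp)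
  have := H.k_pos
  calc p * ‖l - l'‖ * ‖w‖ ^ p * ‖w - 1‖ ≤ p * k * ‖w‖ ^ p * 1 := by gcongr
    _ = k * (p * ‖w‖ ^ p) := by ring
    _ < _ := by gcongr

/-- Near `1` the map expands distances by the factor `p`, and the parameter is negligible. -/
lemma norm_sub_eq_mul {l l' z w : K} (hl : ‖l - 1‖ < 1)
    (hz : ‖z - 1‖ < 1) (hw : ‖w - 1‖ < 1) (h : ‖l - l'‖ ≤ ‖z - w‖) :
    ‖perturbedFamily p q l z - perturbedFamily p q l' w‖ = p * ‖z - w‖ := by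
  have hp := H.p_pos
  rcases eq_or_ne z w with rfl | hne
  · rw [sub_self, norm_zero] at h
    obtain rfl : l = l' := sub_eq_zero.1 (norm_eq_zero.1 (h.antisymm (norm_nonneg _)))
    simp
  have hzw : 0 < ‖z - w‖ := norm_pos_iff.2 (sub_ne_zero.2 hne)
  have hz1 := norm_eq_one_of_sub_one_lt hz
  have hw1 := norm_eq_one_of_sub_one_lt hw
  -- Written as `(l / p) z ^ p (1 - z) + z ^ (p + 1) + q z`, the map varies near 1 mainly through
  -- the factor `1 - z`; the first summand isolates this.
  have hsplit : perturbedFamily p q l z - perturbedFamily p q l' w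
      = -(l / p * (z - w) * z ^ p) + (l / p * ((1 - w) * (z ^ p - w ^ p))
        + ((z ^ (p + 1) - w ^ (p + 1)) + (q z - q w)
          + (perturbedFamily p q l w - perturbedFamily p q l' w))) := by
    rw [perturbedFamily, perturbedFamily, perturbedFamily]; ring
  have h0 : ‖-(l / p * (z - w) * z ^ p)‖ = p * ‖z - w‖ := by
    rw [norm_neg, norm_mul, norm_mul, norm_pow, hz1, H.norm_div_p hl, one_pow, mul_one]
  have hlt : ‖z - w‖ < p * ‖z - w‖ := lt_mul_of_one_lt_left hzw H.one_lt_p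
  have hw1' : ‖1 - w‖ < 1 := by rwa [norm_sub_rev]
  rw [hsplit, norm_add_eq_left, h0]
  rw [h0]
  refine norm_add_lt ?_ (norm_add_lt (norm_add_lt ?_ ?_) ?_)
  · rw [norm_mul, norm_mul, H.norm_div_p hl]
    have := norm_pow_sub_pow_le hz1.le hw1.le (p - 1)
    rw [Nat.sub_add_cancel H.prime.one_le, one_pow, one_mul] at this
    have : ‖1 - w‖ * ‖z ^ p - w ^ p‖ < ‖z - w‖ := by
      calc _ ≤ ‖1 - w‖ * ‖z - w‖ := by gcongr
        _ < _ := mul_lt_of_lt_one_left hzw hw1'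
    gcongr
  · have := norm_pow_sub_pow_le hz1.le hw1.le p
    rw [one_pow, one_mul] at this
    exact this.trans_lt hlt
  · exact ((H.lipschitz z w hz1.le hw1.le).trans
      (mul_le_of_le_one_left hzw.le H.delta_lt_one.le)).trans_lt hlt
  · rw [H.norm_param_sub, hw1, one_pow, mul_one]
    calc p * ‖l - l'‖ * ‖1 - w‖ ≤ p * ‖z - w‖ * ‖1 - w‖ := by gcongr
      _ < _ := mul_lt_of_lt_one_right (by positivity) hw1'

lemma uniformlyPolynomial_param {S : Set K} {g : K → K} (hg : UniformlyPolynomial S g)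
    (hg1 : ∀ l ∈ S, ‖g l‖ ≤ 1) (hS : ∀ l ∈ S, ‖l - 1‖ < 1) :
    UniformlyPolynomial S fun l => perturbedFamily p q l (g l) := by
  have hl1 : ∀ l ∈ S, ‖l‖ ≤ 1 := fun l hl => (norm_eq_one_of_sub_one_lt (hS l hl)).le
  have hp1 : ∀ n, ∀ l ∈ S, ‖g l ^ n‖ ≤ 1 := fun n l hl => by
    rw [norm_pow]; exact pow_le_one₀ (norm_nonneg _) (hg1 l hl)
  have h1 := ((UniformlyPolynomial.id S).mul (hg.pow hg1 p) hl1 (hp1 p)).const_mul (p : K)⁻¹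
  have h2 := ((UniformlyPolynomial.id S).mul (hg.pow hg1 (p + 1)) hl1 (hp1 _)).const_mul
    (p : K)⁻¹
  have h3 := H.uniformlyPolynomial.comp (fun z w hz hw => (H.lipschitz z w hz hw).trans
    (mul_le_of_le_one_left (norm_nonneg _) H.delta_lt_one.le)) hg hg1
  refine (((h1.add (hg.pow hg1 (p + 1))).sub h2).add h3).congr fun l _ => ?_
  rw [perturbedFamily]
  ring

lemma uniformlyPolynomial_apply (l c : K) :
    UniformlyPolynomial (Metric.closedBall 0 1) fun z => perturbedFamily p q l z - c := by
  have hid := UniformlyPolynomial.id (Metric.closedBall (0 : K) 1)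
  have h1 : ∀ z ∈ Metric.closedBall (0 : K) 1, ‖z‖ ≤ 1 := by simp
  exact ((((hid.pow h1 p).const_mul (l / p)).add ((hid.pow h1 (p + 1)).const_mul (1 - l / p))).add
    H.uniformlyPolynomial).sub (UniformlyPolynomial.const _ c)

end estimates

end IsSmallPerturbation

/-! ### Approximate repelling fixed points near 1 -/

namespace IsSmallPerturbation

open Ultrametric

variable {K : Type*} [NontriviallyNormedField K] [IsUltrametricDist K] {p : ℕ} {q : K → K}
  {δ s k : ℝ}

/-- Newton-type iteration converging to the repelling fixed point near `1`. -/
noncomputable def approxFixedPoint (p : ℕ) (q : K → K) : ℕ → K → K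
  | 0, _ => 1
  | i + 1, l => approxFixedPoint p q i l
      + p * (perturbedFamily p q l (approxFixedPoint p q i l) - approxFixedPoint p q i l)

variable (H : IsSmallPerturbation p q δ s k)

include H

/-- The slope of the map near 1 is close to `-l / p`, so `z ↦ z + p (f z - z)` has slope close to `1
- l`, which is small because `l` is close to 1. -/
lemma norm_newton_sub_le {l z w : K} (hl : ‖l - 1‖ < 1) (hz : ‖z - 1‖ ≤ (p : ℝ)⁻¹)
    (hw : ‖w - 1‖ ≤ (p : ℝ)⁻¹) :
    ‖(z + p * (perturbedFamily p q l z - z)) - (w + p * (perturbedFamily p q l w - w))‖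
      ≤ max ‖l - 1‖ (p : ℝ)⁻¹ * ‖z - w‖ := by
  have hp0 := H.p_ne_zero
  have hpi := H.inv_p_lt_one
  have hl1 := norm_eq_one_of_sub_one_lt hl
  have hz1 := norm_eq_one_of_sub_one_lt (hz.trans_lt hpi)
  have hw1 := norm_eq_one_of_sub_one_lt (hw.trans_lt hpi)
  have hpow (n : ℕ) : ‖z ^ (n + 1) - w ^ (n + 1)‖ ≤ ‖z - w‖ := by
    simpa using norm_pow_sub_pow_le hz1.le hw1.le n
  have hpow' := hpow (p - 1)
  rw [Nat.sub_add_cancel H.prime.one_le] at hpow'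
  have : (z + p * (perturbedFamily p q l z - z)) - (w + p * (perturbedFamily p q l w - w))
      = ((1 - l) + l * (1 - z ^ p)) * (z - w) + (l * ((1 - w) * (z ^ p - w ^ p))
        + p * ((z ^ (p + 1) - w ^ (p + 1)) + (q z - q w) - (z - w))) := by
    rw [perturbedFamily, perturbedFamily]
    field_simp
    ring
  rw [this]
  refine norm_add_le' ?_ (norm_add_le' ?_ ?_)
  · rw [norm_mul]
    gcongr
    rw [norm_sub_rev l]
    refine norm_add_le' (le_max_left _ _) ?_
    rw [norm_mul, hl1, one_mul]
    have h := norm_pow_sub_pow_le hz1.le (norm_one (α := K)).le (p - 1)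
    rw [Nat.sub_add_cancel H.prime.one_le, one_pow, one_pow, one_mul, norm_sub_rev] at h
    exact (h.trans hz).trans (le_max_right _ _)
  · rw [norm_mul, norm_mul, hl1, one_mul, norm_sub_rev 1 w]
    gcongr
    exact hw.trans (le_max_right _ _)
  · rw [norm_mul, H.norm_p]
    gcongr
    · exact le_max_right _ _
    · refine norm_sub_le' (norm_add_le' (hpow p) ?_) le_rfl
      exact (H.lipschitz z w hz1.le hw1.le).trans
        (mul_le_of_le_one_left (norm_nonneg _) H.delta_lt_one.le)

lemma norm_approxFixedPoint_sub_one_le {l : K} (hl : ‖l - 1‖ < 1) (i : ℕ) :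
    ‖approxFixedPoint p q i l - 1‖ ≤ (p : ℝ)⁻¹
      ∧ ‖approxFixedPoint p q (i + 1) l - approxFixedPoint p q i l‖
        ≤ max ‖l - 1‖ (p : ℝ)⁻¹ ^ i * (p : ℝ)⁻¹ := by
  have hp := H.p_pos
  have hc : max ‖l - 1‖ (p : ℝ)⁻¹ ≤ 1 := max_le hl.le H.inv_p_lt_one.le
  have hc0 : 0 ≤ max ‖l - 1‖ (p : ℝ)⁻¹ := le_max_of_le_left (norm_nonneg _)
  induction i with
  | zero =>
    refine ⟨by simp [approxFixedPoint], ?_⟩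
    have : perturbedFamily p q l 1 - 1 = q 1 := by rw [perturbedFamily]; ring
    change ‖1 + p * (perturbedFamily p q l 1 - 1) - 1‖ ≤ _
    rw [add_sub_cancel_left, this, norm_mul, H.norm_p, pow_zero, one_mul]
    exact mul_le_of_le_one_right (by positivity)
      ((H.norm_le 1 (by simp)).trans H.delta_lt_one.le)
  | succ i ih =>
    have h1 : ‖approxFixedPoint p q (i + 1) l - 1‖ ≤ (p : ℝ)⁻¹ :=
      norm_sub_le_trans (ih.2.trans (mul_le_of_le_one_left (by positivity)
        (pow_le_one₀ hc0 hc))) ih.1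
    refine ⟨h1, (H.norm_newton_sub_le hl h1 ih.1).trans ?_⟩
    rw [pow_succ', mul_assoc]
    exact mul_le_mul_of_nonneg_left ih.2 hc0

/-- The multiplier `p` of the iteration cancels the factor `p` by which the map amplifies a change
of parameter. -/
lemma norm_approxFixedPoint_sub_le {l l' : K} (hl : ‖l - 1‖ < 1) (hl' : ‖l' - 1‖ < 1) (i : ℕ) :
    ‖approxFixedPoint p q i l - approxFixedPoint p q i l'‖ ≤ ‖l - l'‖ := by
  induction i with
  | zero => simp [approxFixedPoint]
  | succ i ih =>
    have hp := H.p_pos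
    have ha := (H.norm_approxFixedPoint_sub_one_le hl i).1
    have ha' := (H.norm_approxFixedPoint_sub_one_le hl' i).1
    have h1 : ‖approxFixedPoint p q i l'‖ = 1 :=
      norm_eq_one_of_sub_one_lt (ha'.trans_lt H.inv_p_lt_one)
    rw [approxFixedPoint, approxFixedPoint]
    refine norm_sub_le_trans ((H.norm_newton_sub_le hl ha ha').trans ?_) (?_ : _ ≤ ‖l - l'‖)
    · exact (mul_le_of_le_one_left (norm_nonneg _)
        (max_le hl.le H.inv_p_lt_one.le)).trans ih
    · rw [add_sub_add_left_eq_sub, ← mul_sub, sub_sub_sub_cancel_right, norm_mul,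
        H.norm_param_sub, H.norm_p, h1, one_pow, mul_one, norm_sub_rev 1]
      calc (p : ℝ)⁻¹ * (p * ‖l - l'‖ * ‖approxFixedPoint p q i l' - 1‖)
          = ‖l - l'‖ * ‖approxFixedPoint p q i l' - 1‖ := by field_simp
        _ ≤ ‖l - l'‖ := mul_le_of_le_one_right (norm_nonneg _) (ha'.trans H.inv_p_lt_one.le)

/-- Approximate fixed points near `1`, depending nicely on the parameter. -/
lemma exists_approxFixedPoint {S : Set K} {c ε : ℝ} (hc : c < 1) (hS : ∀ l ∈ S, ‖l - 1‖ ≤ c)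
    (hε : 0 < ε) :
    ∃ a : K → K, UniformlyPolynomial S a ∧ (∀ l ∈ S, ‖a l - 1‖ < 1)
      ∧ (∀ l ∈ S, ‖perturbedFamily p q l (a l) - a l‖ < ε)
      ∧ ∀ l ∈ S, ∀ l' ∈ S, ‖a l - a l'‖ ≤ ‖l - l'‖ := by
  have hp := H.p_pos
  have hS' : ∀ l ∈ S, ‖l - 1‖ < 1 := fun l hl => (hS l hl).trans_lt hc
  obtain ⟨i, hi⟩ := exists_pow_lt_of_lt_one hε (max_lt hc H.inv_p_lt_one)
  have h1 : ∀ i, ∀ l ∈ S, ‖approxFixedPoint p q i l‖ ≤ 1 := fun i l hl =>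
    (norm_eq_one_of_sub_one_lt ((H.norm_approxFixedPoint_sub_one_le (hS' l hl) i).1.trans_lt
      H.inv_p_lt_one)).le
  refine ⟨approxFixedPoint p q i, ?_, fun l hl =>
    (H.norm_approxFixedPoint_sub_one_le (hS' l hl) i).1.trans_lt H.inv_p_lt_one, fun l hl => ?_,
    fun l hl l' hl' => H.norm_approxFixedPoint_sub_le (hS' l hl) (hS' l' hl') i⟩
  · clear hi
    induction i with
    | zero => exact UniformlyPolynomial.const S 1
    | succ i ih =>
      exact ih.add (((H.uniformlyPolynomial_param ih (h1 i) hS').sub ih).const_mul p)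
  · have h := (H.norm_approxFixedPoint_sub_one_le (hS' l hl) i).2
    -- The defect of the `i`-th iterate as a fixed point is the next increment divided by `p`.
    rw [approxFixedPoint, add_sub_cancel_left, norm_mul, H.norm_p, mul_comm] at h
    refine (le_of_mul_le_mul_right h (inv_pos.2 hp)).trans_lt (lt_of_le_of_lt ?_ hi)
    have := hS l hl
    gcongr

/-- A point close to an approximate fixed point near `1` stays near `1` for a long time. -/
lemma near_one_of_approxFixedPoint {l a z : K} {N : ℕ} (hl : ‖l - 1‖ < 1) (ha : ‖a - 1‖ < 1)
    (hfa : ‖perturbedFamily p q l a - a‖ ≤ (p : ℝ)⁻¹ ^ N) (hz : ‖z - a‖ ≤ (p : ℝ)⁻¹ ^ N) :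
    (∀ j < N, ‖(perturbedFamily p q l)^[j] z - 1‖ < 1) ∧ ‖(perturbedFamily p q l)^[N] z‖ ≤ 1 := by
  have hp := H.p_pos
  -- Each step multiplies the distance to `a` by at most `p`, and the defect of `a` is too small to
  -- enlarge this bound.
  have key : ∀ j ≤ N, ‖(perturbedFamily p q l)^[j] z - a‖ ≤ (p : ℝ) ^ j * (p : ℝ)⁻¹ ^ N := by
    intro j
    induction j with
    | zero => simpa using hz
    | succ j ih =>
      intro hj
      have h := ih (by omega)
      have hz1 : ‖(perturbedFamily p q l)^[j] z‖ ≤ 1 := by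
        have h2 : ‖(perturbedFamily p q l)^[j] z - a‖ ≤ 1 := by
          refine h.trans ?_
          rw [inv_pow, ← div_eq_mul_inv, div_le_one (by positivity)]
          exact pow_le_pow_right₀ H.one_lt_p.le (by omega)
        have := norm_add_le' h2 (norm_eq_one_of_sub_one_lt ha).le
        rwa [sub_add_cancel] at this
      rw [Function.iterate_succ_apply']
      refine norm_sub_le_trans ((H.norm_sub_le_mul hl hz1 (norm_eq_one_of_sub_one_lt ha).le).trans
        ?_) (hfa.trans (le_mul_of_one_le_left (by positivity) (one_le_pow₀ H.one_lt_p.le)))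
      rw [pow_succ', mul_assoc]
      gcongr
  constructor
  · intro j hj
    refine norm_sub_lt_trans ((key j hj.le).trans_lt ?_) ha
    rw [inv_pow, ← div_eq_mul_inv, div_lt_one (by positivity)]
    exact pow_lt_pow_right₀ H.one_lt_p hj
  · have h2 := key N le_rfl
    rw [inv_pow, mul_inv_cancel₀ (by positivity)] at h2
    have := norm_add_le' h2 (norm_eq_one_of_sub_one_lt ha).le
    rwa [sub_add_cancel] at this

/-! ### Orbit segments in the open unit disc -/

/-- Every point `t` with `s < ‖t‖ ≤ 1` is approximately the image of a point of the open unit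
disc. -/
lemma exists_norm_apply_sub_lt [IsAlgClosed K]
    {l t : K} {ε : ℝ} (hl : ‖l - 1‖ < 1) (ht : ‖t‖ ≤ 1) (hε : 0 < ε) :
    ∃ z, ‖z‖ < 1 ∧ ‖perturbedFamily p q l z - t‖ < ε := by
  have hp := H.p_pos
  -- Beyond radius `k` images have norm greater than 1, whereas the image of 0 is small; so `f - t`
  -- has nonconstant norm on the open unit disc.
  obtain ⟨b, hkb, hb⟩ := exists_lt_norm_lt_of_isAlgClosed (K := K) H.k_pos.le H.k_lt_one
  have hfb : 1 < ‖perturbedFamily p q l b‖ := by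
    have h1 : 1 < p * ‖b‖ ^ p := by
      rw [← H.k_eq]
      have := pow_lt_pow_left₀ hkb H.k_pos.le H.prime.ne_zero
      gcongr
    have h2 : ‖(1 - l / p) * b ^ (p + 1)‖ < ‖l / p * b ^ p‖ := by
      rw [norm_mul, norm_mul, H.norm_div_p hl, H.norm_one_sub_div_p hl, norm_pow, norm_pow,
        pow_succ, ← mul_assoc]
      exact mul_lt_of_lt_one_right (by positivity) hb
    have h3 : ‖l / p * b ^ p + (1 - l / p) * b ^ (p + 1)‖ = p * ‖b‖ ^ p := by
      rw [norm_add_eq_left h2, norm_mul, H.norm_div_p hl, norm_pow]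
    rw [perturbedFamily, norm_add_eq_left, h3]
    · exact h1
    · rw [h3]
      exact ((H.norm_le b hb.le).trans_lt H.delta_lt_one).trans h1
  have h0 : ‖perturbedFamily p q l 0 - t‖ ≤ 1 := by
    refine norm_sub_le' ?_ ht
    have hpz := H.prime.ne_zero
    have : perturbedFamily p q l 0 = q 0 := by simp [perturbedFamily, hpz]
    rw [this]
    exact (H.norm_le 0 (by simp)).trans H.delta_lt_one.le
  have hb' : 1 < ‖perturbedFamily p q l b - t‖ := by
    rw [sub_eq_add_neg, norm_add_eq_left] <;> [exact hfb; (rw [norm_neg]; exact ht.trans_lt hfb)]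
  have hU := (H.uniformlyPolynomial_apply l t).mono (Metric.ball_subset_closedBall)
  obtain ⟨z, hz, hz'⟩ := hU.exists_norm_lt (a := 0) (b := b) (by simp) (by simpa using hb)
    (h0.trans_lt hb') hε
  exact ⟨z, by simpa using hz, hz'⟩

/-- Orbits in the open unit disc that end at a point of norm `> s` consist of such points. -/
lemma lt_norm_iterate {l w : K} {M : ℕ} (hl : ‖l - 1‖ < 1)
    (hw : ∀ j < M, ‖(perturbedFamily p q l)^[j] w‖ < 1)
    (hM : s < ‖(perturbedFamily p q l)^[M] w‖) :
    ∀ j ≤ M, s < ‖(perturbedFamily p q l)^[j] w‖ := by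
  intro j hj
  induction hj using Nat.decreasingInduction with
  | self => exact hM
  | of_succ j hj ih =>
    rw [Function.iterate_succ_apply'] at ih
    exact (H.norm_apply_eq hl (hw j hj) ih).1

/-- Orbits in the same residue classes, for different parameters. -/
lemma norm_iterate_sub_lt_norm {l l' z w : K} {M : ℕ} (hl : ‖l - 1‖ < 1) (hl' : ‖l' - 1‖ < 1)
    (hw : ∀ j < M, ‖(perturbedFamily p q l')^[j] w‖ < 1)
    (hM : s < ‖(perturbedFamily p q l')^[M] w‖) (hzw : ‖z - w‖ < ‖w‖) :
    ∀ j ≤ M, ‖(perturbedFamily p q l)^[j] z - (perturbedFamily p q l')^[j] w‖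
      < ‖(perturbedFamily p q l')^[j] w‖ := by
  have hs := H.lt_norm_iterate hl' hw hM
  intro j
  induction j with
  | zero => exact fun _ => hzw
  | succ j ih =>
    intro hj
    have h := hs (j + 1) hj
    rw [Function.iterate_succ_apply'] at h
    rw [Function.iterate_succ_apply', Function.iterate_succ_apply']
    exact H.norm_sub_lt_norm hl hl' (hw j hj) h (ih (by omega))

/-- There are orbits that spend any given number of steps in the open unit disc before they reach
a given residue class. -/
lemma exists_path [IsAlgClosed K]
    {l : K} (hl : ‖l - 1‖ < 1) (M : ℕ) :
    ∀ u : K, s < ‖u‖ → ‖u‖ ≤ 1 → ∃ t, (∀ j < M, ‖(perturbedFamily p q l)^[j] t‖ < 1) ∧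
      ‖(perturbedFamily p q l)^[M] t - u‖ < ‖u‖ := by
  induction M with
  | zero =>
    intro u hu _
    exact ⟨u, by simp, by simpa using H.s_pos.trans hu⟩
  | succ M ih =>
    intro u hu hu1
    -- The path is built backwards. An approximate preimage is enough, since points relatively close
    -- to `v` have images relatively close to that of `v`.
    obtain ⟨v, hv, hfv⟩ := H.exists_norm_apply_sub_lt hl hu1 (H.s_pos.trans hu)
    have hfvn := norm_eq_of_sub_lt hfv
    have hfvs : s < ‖perturbedFamily p q l v‖ := by rwa [hfvn]
    obtain ⟨t, ht, htv⟩ := ih v (H.norm_apply_eq hl hv hfvs).1 hv.le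
    refine ⟨t, fun j hj => ?_, ?_⟩
    · rcases (Nat.lt_succ_iff_lt_or_eq.1 hj) with hj | rfl
      · exact ht j hj
      · rw [norm_eq_of_sub_lt htv]; exact hv
    · rw [Function.iterate_succ_apply']
      have := H.norm_sub_lt_norm hl hl hv hfvs htv
      rw [hfvn] at this
      exact norm_sub_lt_trans this hfv

/-- Contraction along an orbit segment in the open unit disc. -/
lemma norm_iterate_sub_le {l l' z w : K} {M : ℕ} {d σ : ℝ} (hl' : ‖l' - 1‖ < 1)
    (hw : ∀ j ≤ M, ‖(perturbedFamily p q l')^[j] w‖ < 1)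
    (hM : ‖(perturbedFamily p q l')^[M + 1] w‖ = 1) (hd : d ≤ (p : ℝ)⁻¹ ^ 2)
    (hσ : σ ≤ (p : ℝ)⁻¹ ^ 2) (hzw : ‖z - w‖ ≤ d) (hll' : ‖l - l'‖ ≤ σ) :
    (∀ j ≤ M, ‖(perturbedFamily p q l)^[j] z - (perturbedFamily p q l')^[j] w‖
      ≤ max (k ^ j * d) (k * σ)) ∧
    ‖(perturbedFamily p q l)^[M + 1] z - perturbedFamily p q l' ((perturbedFamily p q l)^[M] z)‖
      = ‖l - l'‖ ∧
    ‖perturbedFamily p q l' ((perturbedFamily p q l)^[M] z) - (perturbedFamily p q l')^[M + 1] w‖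
      ≤ max (k ^ M * d) (k * σ) := by
  have hp := H.p_pos
  have hk0 := H.k_pos
  have hk1 := H.k_lt_one
  have hd0 : 0 ≤ d := (norm_nonneg _).trans hzw
  have hσ0 : 0 ≤ σ := (norm_nonneg _).trans hll'
  have hws := H.lt_norm_iterate hl' (fun j hj => hw j (Nat.lt_succ_iff.1 hj))
    (by rw [hM]; exact H.s_lt_one)
  have hwle : ∀ j ≤ M + 1, ‖(perturbedFamily p q l')^[j] w‖ ≤ 1 := fun j hj => by
    rcases hj.eq_or_lt with rfl | hj
    · exact hM.le
    · exact (hw j (by omega)).le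
  have hsucc : ∀ j ≤ M, ‖(perturbedFamily p q l')^[j + 1] w‖
      = p * ‖(perturbedFamily p q l')^[j] w‖ ^ p := fun j hj => by
    have := hws (j + 1) (by omega)
    rw [Function.iterate_succ_apply'] at this ⊢
    exact (H.norm_apply_eq hl' (hw j hj) this).2
  have hwk : ∀ j ≤ M, ‖(perturbedFamily p q l')^[j] w‖ ≤ k := fun j hj => by
    have h1 := hws (j + 1) (by omega)
    have h2 := hwle (j + 1) (by omega)
    rw [Function.iterate_succ_apply'] at h1 h2
    exact H.norm_le_k_of hl' (hw j hj) h1 h2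
  have hsmall : ∀ j, max (k ^ j * d) (k * σ) ≤ (p : ℝ)⁻¹ ^ 2 := fun j =>
    max_le ((mul_le_of_le_one_left hd0 (pow_le_one₀ hk0.le hk1.le)).trans hd)
      ((mul_le_of_le_one_left hσ0 hk1.le).trans hσ)
  have hps : (p : ℝ)⁻¹ ^ 2 ≤ s := (pow_le_of_le_one (inv_nonneg.2 hp.le) H.inv_p_lt_one.le
    two_ne_zero).trans H.inv_p_le_s
  have hnorm : ∀ j ≤ M, ‖(perturbedFamily p q l)^[j] z - (perturbedFamily p q l')^[j] w‖
      ≤ max (k ^ j * d) (k * σ) →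
      ‖(perturbedFamily p q l)^[j] z‖ = ‖(perturbedFamily p q l')^[j] w‖ := fun j hj h =>
    norm_eq_of_sub_lt ((h.trans ((hsmall j).trans hps)).trans_lt (hws j (by omega)))
  -- A change of parameter enters each step scaled by the norm of the next orbit point: at most `k`
  -- inside the disc, exactly 1 on the arriving step.
  have hparam : ∀ j ≤ M, ‖(perturbedFamily p q l)^[j] z - (perturbedFamily p q l')^[j] w‖
      ≤ max (k ^ j * d) (k * σ) →
      ‖(perturbedFamily p q l)^[j + 1] z
        - perturbedFamily p q l' ((perturbedFamily p q l)^[j] z)‖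
      = ‖l - l'‖ * ‖(perturbedFamily p q l')^[j + 1] w‖ := fun j hj h => by
    have h1 := hnorm j hj h
    have h2 : ‖1 - (perturbedFamily p q l)^[j] z‖ = 1 := by
      rw [sub_eq_add_neg, norm_add_eq_left, norm_one]
      rw [norm_neg, norm_one, h1]
      exact hw j hj
    rw [Function.iterate_succ_apply', H.norm_param_sub, h2, h1, hsucc j hj]
    ring
  -- The contraction factor is `k` while the next point is in the disc and 1 on the arriving step,
  -- hence the exponent `M` rather than `M + 1` in the final bound.
  have hfirst : ∀ j ≤ M, ‖(perturbedFamily p q l)^[j] z - (perturbedFamily p q l')^[j] w‖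
      ≤ max (k ^ j * d) (k * σ) →
      ‖perturbedFamily p q l' ((perturbedFamily p q l)^[j] z)
        - (perturbedFamily p q l')^[j + 1] w‖
      ≤ max k ‖(perturbedFamily p q l')^[j + 1] w‖ * max (k ^ j * d) (k * σ) := fun j hj h => by
    rw [hsucc j hj, Function.iterate_succ_apply']
    refine (H.norm_sub_le_of_small hl' (hnorm j hj h).le le_rfl (hwk j hj)
      (h.trans (hsmall j))).trans ?_
    gcongr
  have hmain : ∀ j ≤ M, ‖(perturbedFamily p q l)^[j] z - (perturbedFamily p q l')^[j] w‖
      ≤ max (k ^ j * d) (k * σ) := by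
    intro j
    induction j with
    | zero => intro _; simpa using Or.inl hzw
    | succ j ih =>
      intro hj
      have hj' : j ≤ M := by omega
      have h := ih hj'
      refine norm_sub_le_trans ((hparam j hj' h).le.trans ?_) ((hfirst j hj' h).trans ?_)
      · refine le_max_of_le_right ?_
        rw [mul_comm]
        have := hwk (j + 1) hj
        gcongr
      · rw [max_eq_left (hwk (j + 1) hj), mul_max_of_nonneg _ _ hk0.le]
        refine max_le_max (by rw [pow_succ', mul_assoc]) ?_
        exact mul_le_of_le_one_left (by positivity) hk1.le
  refine ⟨hmain, ?_, ?_⟩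
  · rw [hparam M le_rfl (hmain M le_rfl), hM, mul_one]
  · have := hfirst M le_rfl (hmain M le_rfl)
    rwa [hM, max_eq_right hk1.le, one_mul] at this

/-- Large relative distances along an orbit segment in the open unit disc. -/
lemma norm_iterate_sub_eq_pow {l l' z w : K} {M : ℕ} {τ : ℝ} (hl : ‖l - 1‖ < 1)
    (hl' : ‖l' - 1‖ < 1) (hll' : ‖l - l'‖ ≤ k)
    (hw : ∀ j < M, ‖(perturbedFamily p q l')^[j] w‖ < 1)
    (hM : ‖(perturbedFamily p q l')^[M] w‖ = 1) (hτ0 : 0 ≤ τ) (hτ1 : τ < 1)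
    (hτ : k < τ ^ p ^ M) (hzw : ‖z - w‖ = τ * ‖w‖) :
    ∀ j ≤ M, ‖(perturbedFamily p q l)^[j] z - (perturbedFamily p q l')^[j] w‖
      = τ ^ p ^ j * ‖(perturbedFamily p q l')^[j] w‖ := by
  have hws := H.lt_norm_iterate hl' hw (by rw [hM]; exact H.s_lt_one)
  intro j
  induction j with
  | zero => intro _; simpa using hzw
  | succ j ih =>
    intro hj
    have h1 := hws (j + 1) hj
    have h2 : ‖(perturbedFamily p q l')^[j + 1] w‖ ≤ 1 := by
      rcases hj.eq_or_lt with rfl | hj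
      · exact hM.le
      · exact (hw _ hj).le
    rw [Function.iterate_succ_apply'] at h1 h2
    have h3 := pow_lt_one₀ hτ0 hτ1 (pow_ne_zero j H.prime.ne_zero)
    have h4 : k < (τ ^ p ^ j) ^ p := by
      rw [← pow_mul, ← pow_succ]
      exact hτ.trans_le (pow_le_pow_of_le_one hτ0 hτ1.le
        (Nat.pow_le_pow_right H.prime.pos hj))
    rw [Function.iterate_succ_apply', Function.iterate_succ_apply', pow_succ p, pow_mul]
    exact H.norm_sub_eq_pow hl hl' hll' (hw j hj) h1 h2 (by positivity) h3 h4 (ih (by omega))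

end IsSmallPerturbation

/-! ### Parameters with a landing near 1 -/

namespace IsSmallPerturbation

open Ultrametric

/-- For the parameter `l`, the orbit of `x` arrives near `1` at time `n` and stays there for `N + 1`
steps, and its position at time `n` moves isometrically with the parameter near `l`. -/
structure IsLanding {K : Type*} [NormedField K] (p : ℕ) (q : K → K) (x : K) (n N : ℕ) (l : K) :
    Prop where
  param : ‖l - 1‖ < 1
  isometry : ∀ μ μ', ‖μ - l‖ < (p : ℝ)⁻¹ ^ N → ‖μ' - l‖ < (p : ℝ)⁻¹ ^ N →
    ‖(perturbedFamily p q μ)^[n] x - (perturbedFamily p q μ')^[n] x‖ = ‖μ - μ'‖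
  close : ∀ μ, ‖μ - l‖ < (p : ℝ)⁻¹ ^ N → ∀ m ≤ n,
    ‖(perturbedFamily p q μ)^[m] x - (perturbedFamily p q l)^[m] x‖ < 1
  bounded : ∀ m ≤ n, ‖(perturbedFamily p q l)^[m] x‖ ≤ 1
  near_one : ∀ j ≤ N, ‖(perturbedFamily p q l)^[n + j] x - 1‖ < 1
  last : ‖(perturbedFamily p q l)^[n + N + 1] x‖ ≤ 1

variable {K : Type*} [NontriviallyNormedField K] [IsUltrametricDist K] {p : ℕ} {q : K → K}
  {δ s k : ℝ} (H : IsSmallPerturbation p q δ s k)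

include H

lemma uniformlyPolynomial_iterate {S : Set K} {x : K} {m : ℕ} (hS : ∀ l ∈ S, ‖l - 1‖ < 1)
    (hx : ∀ l ∈ S, ∀ j < m, ‖(perturbedFamily p q l)^[j] x‖ ≤ 1) :
    UniformlyPolynomial S fun l => (perturbedFamily p q l)^[m] x := by
  induction m with
  | zero => exact UniformlyPolynomial.const S x
  | succ m ih =>
    refine (H.uniformlyPolynomial_param (ih fun l hl j hj => hx l hl j (by omega))
      (fun l hl => hx l hl m (by omega)) hS).congr fun l _ => ?_
    rw [Function.iterate_succ_apply']

namespace IsLanding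

variable {x l : K} {n N : ℕ} (h : IsLanding p q x n N l)

include h

omit H in
lemma param_of (hp : p.Prime) {μ : K} (hμ : ‖μ - l‖ < (p : ℝ)⁻¹ ^ N) : ‖μ - 1‖ < 1 :=
  norm_sub_lt_trans (hμ.trans_le (pow_le_one₀ (by positivity)
    (inv_le_one_of_one_le₀ (by exact_mod_cast hp.one_le)))) h.param

/-- The isometry on arrival makes the distance of the points at least that of the parameters, which
is the condition for `norm_sub_eq_mul`, and expansion preserves it. Comparison with the centre `l`
keeps both orbits near 1. -/
lemma expansion {μ μ' : K} (hμ : ‖μ - l‖ < (p : ℝ)⁻¹ ^ N) (hμ' : ‖μ' - l‖ < (p : ℝ)⁻¹ ^ N) :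
    ∀ j ≤ N + 1, ‖(perturbedFamily p q μ)^[n + j] x - (perturbedFamily p q μ')^[n + j] x‖
      = p ^ j * ‖μ - μ'‖ := by
  have hp := H.p_pos
  have key : ∀ j ≤ N + 1, ∀ μ μ' : K, ‖μ - l‖ < (p : ℝ)⁻¹ ^ N → ‖μ' - l‖ < (p : ℝ)⁻¹ ^ N →
      ‖(perturbedFamily p q μ)^[n + j] x - (perturbedFamily p q μ')^[n + j] x‖
        = p ^ j * ‖μ - μ'‖ := by
    intro j
    induction j with
    | zero => intro _ μ μ' hμ hμ'; simpa using h.isometry μ μ' hμ hμ'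
    | succ j ih =>
      intro hj μ μ' hμ hμ'
      have near : ∀ ν, ‖ν - l‖ < (p : ℝ)⁻¹ ^ N →
          ‖(perturbedFamily p q ν)^[n + j] x - 1‖ < 1 := fun ν hν => by
        refine norm_sub_lt_trans ?_ (h.near_one j (by omega))
        rw [ih (by omega) ν l hν (by simpa using by positivity)]
        calc _ < (p : ℝ) ^ j * (p : ℝ)⁻¹ ^ N := by gcongr
          _ ≤ 1 := H.p_pow_mul_inv_pow (by omega)
      have e := ih (by omega) μ μ' hμ hμ'
      rw [← add_assoc, Function.iterate_succ_apply', Function.iterate_succ_apply',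
        H.norm_sub_eq_mul (h.param_of H.prime hμ) (near μ hμ) (near μ' hμ'), e, pow_succ',
        mul_assoc]
      rw [e]
      exact le_mul_of_one_le_left (norm_nonneg _) (one_le_pow₀ H.one_lt_p.le)
  exact fun j hj => key j hj μ μ' hμ hμ'

lemma near_one_of {μ : K} (hμ : ‖μ - l‖ < (p : ℝ)⁻¹ ^ N) {j : ℕ} (hj : j ≤ N) :
    ‖(perturbedFamily p q μ)^[n + j] x - 1‖ < 1 := by
  have hp := H.p_pos
  refine norm_sub_lt_trans ?_ (h.near_one j hj)
  rw [h.expansion H hμ (by simpa using by positivity) j (by omega)]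
  calc _ < (p : ℝ) ^ j * (p : ℝ)⁻¹ ^ N := by gcongr
    _ ≤ 1 := H.p_pow_mul_inv_pow hj

lemma bounded_of {μ : K} (hμ : ‖μ - l‖ < (p : ℝ)⁻¹ ^ N) {m : ℕ} (hm : m < n + N + 1) :
    ‖(perturbedFamily p q μ)^[m] x‖ ≤ 1 := by
  rcases lt_or_ge m n with hmn | hmn
  · have := norm_add_le' (h.close μ hμ m hmn.le).le (h.bounded m hmn.le)
    rwa [sub_add_cancel] at this
  · obtain ⟨j, rfl⟩ := Nat.exists_eq_add_of_le hmn
    exact (norm_eq_one_of_sub_one_lt (h.near_one_of H hμ (by omega))).le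

/-- The exit point from the neighbourhood of `1` can be prescribed approximately. -/
lemma exists_exit [IsAlgClosed K] {t : K} (ht : ‖t‖ ≤ 1) {ε : ℝ} (hε : 0 < ε) :
    ∃ μ, ‖μ - l‖ < (p : ℝ)⁻¹ ^ N ∧ ‖(perturbedFamily p q μ)^[n + N + 1] x - t‖ < ε := by
  have hp := H.p_pos
  have hlt : (p : ℝ)⁻¹ ^ (N + 1) < (p : ℝ)⁻¹ ^ N :=
    pow_lt_pow_right_of_lt_one₀ (inv_pos.2 hp) H.inv_p_lt_one (Nat.lt_succ_self N)
  -- Moving the parameter by such a `b` moves the exit point by `p ^ (N + 1) * ‖b‖ > 1`, so its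
  -- distance to `t` has nonconstant norm on the ball.
  obtain ⟨b, hb1, hb2⟩ := exists_lt_norm_lt_of_isAlgClosed (K := K) (by positivity) hlt
  have hll : ‖l - l‖ < (p : ℝ)⁻¹ ^ N := by simpa using by positivity
  have hbl : ‖l + b - l‖ < (p : ℝ)⁻¹ ^ N := by simpa using hb2
  have hU := (H.uniformlyPolynomial_iterate (S := Metric.ball l ((p : ℝ)⁻¹ ^ N)) (x := x)
    (m := n + N + 1) (fun μ hμ => h.param_of H.prime (mem_ball_iff_norm.1 hμ))
    (fun μ hμ j hj => h.bounded_of H (mem_ball_iff_norm.1 hμ) hj)).sub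
    (UniformlyPolynomial.const _ t)
  refine hU.exists_norm_lt (a := l) (b := l + b) hll hbl ?_ hε
  have h1 : ‖(perturbedFamily p q l)^[n + N + 1] x - t‖ ≤ 1 := norm_sub_le' h.last ht
  refine h1.trans_lt ?_
  have h2 := h.expansion H hbl hll (N + 1) le_rfl
  rw [← add_assoc, add_sub_cancel_left] at h2
  have h3 : 1 < (p : ℝ) ^ (N + 1) * ‖b‖ := by
    rw [inv_pow, inv_lt_iff_one_lt_mul₀ (by positivity)] at hb1
    rwa [mul_comm]
  rw [← h2] at h3
  rw [← sub_add_sub_cancel _ ((perturbedFamily p q l)^[n + N + 1] x), norm_add_eq_left]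
  · exact h3
  · exact h1.trans_lt h3

end IsLanding

end IsSmallPerturbation

/-! ### The inductive step: exit, return, longer landing -/

namespace IsSmallPerturbation

open Ultrametric

variable {K : Type*} [NontriviallyNormedField K] [IsUltrametricDist K] [IsAlgClosed K]
  {p : ℕ} {q : K → K} {δ s k : ℝ} (H : IsSmallPerturbation p q δ s k)

include H

/-- After leaving the neighbourhood of `1`, the orbit can be made to spend `M + 1` steps in the open
unit disc and to come back extremely close to the repelling fixed point. -/
lemma IsLanding.exists_return {x l : K} {n N M : ℕ} (h : IsLanding p q x n N l) {ε : ℝ}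
    (hε : 0 < ε) :
    ∃ t l₁ l₂ : K, (∀ j < M + 1, ‖(perturbedFamily p q l)^[j] t‖ < 1)
      ∧ ‖(perturbedFamily p q l)^[M + 1] t - 1‖ < 1
      ∧ ‖l₁ - l‖ < (p : ℝ)⁻¹ ^ N
      ∧ ‖l₂ - l₁‖ < (p : ℝ)⁻¹ ^ (N + 1) * ‖t‖
      ∧ (∀ μ, ‖μ - l₁‖ < (p : ℝ)⁻¹ ^ (N + 1) * ‖t‖ → ‖μ - l‖ < (p : ℝ)⁻¹ ^ N)
      ∧ (∀ μ, ‖μ - l₁‖ < (p : ℝ)⁻¹ ^ (N + 1) * ‖t‖ → ∀ j ≤ M + 1,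
        ‖(perturbedFamily p q μ)^[n + N + 1 + j] x - (perturbedFamily p q l)^[j] t‖
          < ‖(perturbedFamily p q l)^[j] t‖)
      ∧ ∃ a : K, ‖a - 1‖ < 1 ∧ ‖perturbedFamily p q l₂ a - a‖ < ε
        ∧ ‖(perturbedFamily p q l₂)^[n + N + 1 + (M + 1)] x - a‖ < ε := by
  have hp := H.p_pos
  obtain ⟨t, ht, htM⟩ := H.exists_path h.param (M + 1) 1 (by simpa using H.s_lt_one) (by simp)
  rw [norm_one] at htM
  have htM1 := norm_eq_one_of_sub_one_lt htM
  have htM2 : s < ‖(perturbedFamily p q l)^[M + 1] t‖ := by rw [htM1]; exact H.s_lt_one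
  have hts : s < ‖t‖ := H.lt_norm_iterate h.param ht htM2 0 (Nat.zero_le _)
  have ht0 : 0 < ‖t‖ := H.s_pos.trans hts
  have ht1 : ‖t‖ < 1 := ht 0 (Nat.succ_pos _)
  obtain ⟨l₁, hl₁, hl₁t⟩ := h.exists_exit H ht1.le ht0
  -- Parameters within `r` of `l₁` have exit points that differ by less than `‖t‖`, so they all
  -- shadow the path of `t`.
  set r : ℝ := (p : ℝ)⁻¹ ^ (N + 1) * ‖t‖ with hr
  have hr0 : 0 < r := by positivity
  have hpN : (p : ℝ)⁻¹ ^ (N + 1) ≤ (p : ℝ)⁻¹ := by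
    rw [pow_succ]
    exact mul_le_of_le_one_left (by positivity) (H.inv_p_pow_le_one N)
  have hrp : r ≤ (p : ℝ)⁻¹ := (mul_le_of_le_one_right (by positivity) ht1.le).trans hpN
  have hrN : r ≤ (p : ℝ)⁻¹ ^ N := by
    refine (mul_le_of_le_one_right (by positivity) ht1.le).trans ?_
    rw [pow_succ]
    exact mul_le_of_le_one_right (by positivity) H.inv_p_lt_one.le
  have hβ : ∀ μ, ‖μ - l₁‖ < r → ‖μ - l‖ < (p : ℝ)⁻¹ ^ N := fun μ hμ =>
    norm_sub_lt_trans (hμ.trans_le hrN) hl₁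
  have hit : ∀ μ j, (perturbedFamily p q μ)^[n + N + 1 + j] x
      = (perturbedFamily p q μ)^[j] ((perturbedFamily p q μ)^[n + N + 1] x) := fun μ j => by
    rw [add_comm, Function.iterate_add_apply]
  have hexp : ∀ μ, ‖μ - l₁‖ < r → ‖(perturbedFamily p q μ)^[n + N + 1] x
      - (perturbedFamily p q l₁)^[n + N + 1] x‖ = p ^ (N + 1) * ‖μ - l₁‖ := fun μ hμ => by
    simpa [add_assoc] using h.expansion H (hβ μ hμ) hl₁ (N + 1) le_rfl
  have hpr : (p : ℝ) ^ (N + 1) * r = ‖t‖ := by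
    rw [hr, inv_pow, mul_inv_cancel_left₀ (by positivity)]
  have hshadow : ∀ μ, ‖μ - l₁‖ < r → ∀ j ≤ M + 1,
      ‖(perturbedFamily p q μ)^[n + N + 1 + j] x - (perturbedFamily p q l)^[j] t‖
        < ‖(perturbedFamily p q l)^[j] t‖ := fun μ hμ => by
    have h1 : ‖(perturbedFamily p q μ)^[n + N + 1] x - t‖ < ‖t‖ := by
      refine norm_sub_lt_trans ?_ hl₁t
      rw [hexp μ hμ, ← hpr]
      gcongr
    simp only [hit]
    exact H.norm_iterate_sub_lt_norm (h.param_of H.prime (hβ μ hμ)) h.param ht htM2 h1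
  have hnorm : ∀ μ, ‖μ - l₁‖ < r → ∀ j ≤ M + 1, ‖(perturbedFamily p q μ)^[n + N + 1 + j] x‖
      = ‖(perturbedFamily p q l)^[j] t‖ := fun μ hμ j hj => norm_eq_of_sub_lt (hshadow μ hμ j hj)
  have hS : ∀ μ ∈ Metric.ball l₁ r, ‖μ - 1‖ ≤ max ‖l₁ - 1‖ (p : ℝ)⁻¹ := fun μ hμ =>
    norm_sub_le_trans (((mem_ball_iff_norm.1 hμ).le.trans hrp).trans (le_max_right _ _))
      (le_max_left _ _)
  have hl₁1 : ‖l₁ - 1‖ < 1 := h.param_of H.prime hl₁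
  obtain ⟨a, haU, ha1, haf, halip⟩ := H.exists_approxFixedPoint
    (max_lt hl₁1 H.inv_p_lt_one) hS hε
  have hU : UniformlyPolynomial (Metric.ball l₁ r)
      fun μ => (perturbedFamily p q μ)^[n + N + 1 + (M + 1)] x - a μ := by
    refine (H.uniformlyPolynomial_iterate
      (fun μ hμ => h.param_of H.prime (hβ μ (mem_ball_iff_norm.1 hμ))) fun μ hμ j hj => ?_).sub haU
    rw [mem_ball_iff_norm] at hμ
    rcases lt_or_ge j (n + N + 1) with hj' | hj'
    · exact h.bounded_of H (hβ μ hμ) hj'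
    · obtain ⟨i, rfl⟩ := Nat.exists_eq_add_of_le hj'
      rw [hnorm μ hμ i (by omega)]
      exact (ht i (by omega)).le
  have hl₁r : ‖l₁ - l₁‖ < r := by simpa using hr0
  have hl₁m : l₁ ∈ Metric.ball l₁ r := mem_ball_iff_norm.2 hl₁r
  set ρ := ‖(perturbedFamily p q l₁)^[n + N + 1 + (M + 1)] x - a l₁‖ with hρ
  have hland : ∀ μ, ‖μ - l₁‖ < r →
      ‖(perturbedFamily p q μ)^[n + N + 1 + (M + 1)] x - 1‖ < 1 := fun μ hμ =>
    norm_sub_lt_trans (by simpa only [htM1] using hshadow μ hμ (M + 1) le_rfl) htM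
  have hρ1 : ρ < 1 := norm_sub_lt_trans (hland l₁ hl₁r) (by rw [norm_sub_rev]; exact ha1 _ hl₁m)
  -- a parameter for which the landing point moves by more than `ρ`
  obtain ⟨τ₀, hτ₀0, hτ₀1, hτ₀⟩ : ∃ τ₀ : ℝ, 0 ≤ τ₀ ∧ τ₀ < 1 ∧ max k ρ < τ₀ ^ p ^ (M + 1) := by
    have hθ : max k ρ < 1 := max_lt H.k_lt_one hρ1
    have hθ0 : 0 < max k ρ := lt_max_of_lt_left H.k_pos
    obtain ⟨P, hP⟩ : ∃ P, P = p ^ (M + 1) := ⟨_, rfl⟩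
    have hP0 : (0 : ℝ) < P := by
      rw [hP]; exact_mod_cast pow_pos H.prime.pos _
    have hP1 : (1 : ℝ) ≤ P := by exact_mod_cast Nat.one_le_iff_ne_zero.2 (by
      rw [hP]; exact pow_ne_zero _ H.prime.ne_zero)
    have hb : (1 - max k ρ) / (2 * P) ≤ 1 := by
      rw [div_le_one (by positivity)]; linarith
    have hb0 : 0 < (1 - max k ρ) / (2 * P) := div_pos (by linarith) (by positivity)
    -- Chosen so that Bernoulli's inequality bounds the `P`-th power below by the midpoint of `max k
    -- ρ` and 1.
    refine ⟨1 + -((1 - max k ρ) / (2 * P)), by linarith, by linarith, ?_⟩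
    rw [← hP]
    refine lt_of_lt_of_le ?_ (one_add_mul_le_pow (by linarith) P)
    have : (P : ℝ) * -((1 - max k ρ) / (2 * P)) = -((1 - max k ρ) / 2) := by field_simp
    rw [this]
    linarith
  obtain ⟨b, hb1, hb2⟩ := exists_lt_norm_lt_of_isAlgClosed (K := K)
    (mul_nonneg hr0.le hτ₀0) (mul_lt_of_lt_one_right hr0 hτ₀1)
  have hb : ‖l₁ + b - l₁‖ < r := by simpa using hb2
  have hbm : l₁ + b ∈ Metric.ball l₁ r := mem_ball_iff_norm.2 hb
  have hτ1 : ‖b‖ / r < 1 := (div_lt_one hr0).2 hb2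
  have hτ0 : τ₀ < ‖b‖ / r := by rwa [lt_div_iff₀' hr0]
  have hτ : max k ρ < (‖b‖ / r) ^ p ^ (M + 1) := hτ₀.trans_le (by gcongr)
  have hbl : ‖l₁ + b - l₁‖ ≤ k := hb.le.trans (hrp.trans H.inv_p_lt_k.le)
  have hl₁norm : ‖(perturbedFamily p q l₁)^[n + N + 1] x‖ = ‖t‖ :=
    hnorm l₁ hl₁r 0 (Nat.zero_le _)
  have hmove : ‖(perturbedFamily p q (l₁ + b))^[n + N + 1 + (M + 1)] x
      - (perturbedFamily p q l₁)^[n + N + 1 + (M + 1)] x‖ = (‖b‖ / r) ^ p ^ (M + 1) := by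
    have h1 : ‖(perturbedFamily p q l₁)^[M + 1] ((perturbedFamily p q l₁)^[n + N + 1] x)‖ = 1 := by
      rw [← hit, hnorm l₁ hl₁r _ le_rfl, htM1]
    have := H.norm_iterate_sub_eq_pow (h.param_of H.prime (hβ _ hb)) hl₁1 hbl
      (z := (perturbedFamily p q (l₁ + b))^[n + N + 1] x)
      (w := (perturbedFamily p q l₁)^[n + N + 1] x) (M := M + 1) (τ := ‖b‖ / r)
      (fun j hj => by rw [← hit, hnorm l₁ hl₁r _ hj.le]; exact ht j hj)
      h1 (by positivity) hτ1 ((le_max_left _ _).trans_lt hτ) (by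
        rw [hexp _ hb, add_sub_cancel_left, hl₁norm, ← hpr]
        field_simp) (M + 1) le_rfl
    rwa [← hit, ← hit, hit l₁, h1, mul_one, ← hit] at this
  -- The landing point moves by more than `max k ρ`, while the approximate fixed point moves by at
  -- most `‖b‖ ≤ k`; hence the norm of their difference is not constant.
  have hbig : ρ < ‖(perturbedFamily p q (l₁ + b))^[n + N + 1 + (M + 1)] x - a (l₁ + b)‖ := by
    have h1 : ‖(perturbedFamily p q l₁)^[n + N + 1 + (M + 1)] x - a (l₁ + b)‖ ≤ max k ρ :=
      norm_sub_le_trans (le_max_right _ _) ((halip _ hl₁m _ hbm).trans (by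
        rw [norm_sub_rev]; exact hbl.trans (le_max_left _ _)))
    rw [← sub_add_sub_cancel _ ((perturbedFamily p q l₁)^[n + N + 1 + (M + 1)] x),
      norm_add_eq_left, hmove]
    · exact (le_max_right _ _).trans_lt hτ
    · rw [hmove]
      exact h1.trans_lt hτ
  obtain ⟨l₂, hl₂, hl₂a⟩ := hU.exists_norm_lt hl₁r hb hbig hε
  have hl₂m : l₂ ∈ Metric.ball l₁ r := mem_ball_iff_norm.2 hl₂
  exact ⟨t, l₁, l₂, ht, htM, hl₁, hl₂, hβ, hshadow, a l₂, ha1 _ hl₂m, haf _ hl₂m, hl₂a⟩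

/-- The inductive step: a parameter with a landing is perturbed to one whose orbit exits,
spends a long time in the open unit disc, and lands again for a longer time. -/
lemma IsLanding.exists_next {x l : K} {n N M : ℕ} (h : IsLanding p q x n N l)
    (hM : k ^ M ≤ (p : ℝ)⁻¹ ^ (N + 5)) :
    ∃ l', ‖l' - l‖ < (p : ℝ)⁻¹ ^ N ∧ IsLanding p q x (n + N + 1 + (M + 1)) (N + 4) l'
      ∧ (∀ j ≤ N, ‖(perturbedFamily p q l')^[n + j] x - 1‖ < 1)
      ∧ ∀ j ≤ M, ‖(perturbedFamily p q l')^[n + N + 1 + j] x‖ < 1 := by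
  have hp := H.p_pos
  have hk0 := H.k_pos
  -- Precision `p⁻¹ ^ (N + 5)` keeps the orbit near 1 for `N + 5` steps, one more than the index `N
  -- + 4` of the new landing.
  obtain ⟨t, l₁, l₂, ht, htM, hl₁, hl₂, hβ, hshadow, a, ha1, haf, hl₂a⟩ :=
    h.exists_return H (M := M) (ε := (p : ℝ)⁻¹ ^ (N + 5)) (by positivity)
  have htM1 := norm_eq_one_of_sub_one_lt htM
  have hts : s < ‖t‖ := H.lt_norm_iterate h.param ht (by rw [htM1]; exact H.s_lt_one)
    0 (Nat.zero_le _)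
  have hinv := H.inv_p_lt_one
  have hball : ∀ μ, ‖μ - l₂‖ < (p : ℝ)⁻¹ ^ (N + 4) → ‖μ - l₁‖ < (p : ℝ)⁻¹ ^ (N + 1) * ‖t‖ := by
    intro μ hμ
    refine norm_sub_lt_trans (hμ.trans_le ?_) hl₂
    calc (p : ℝ)⁻¹ ^ (N + 4) ≤ (p : ℝ)⁻¹ ^ (N + 2) :=
          pow_le_pow_of_le_one (by positivity) hinv.le (by omega)
      _ = (p : ℝ)⁻¹ ^ (N + 1) * (p : ℝ)⁻¹ := pow_succ _ _
      _ ≤ _ := by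
        have := H.inv_p_le_s.trans hts.le
        gcongr
  have hit : ∀ μ j, (perturbedFamily p q μ)^[n + N + 1 + j] x
      = (perturbedFamily p q μ)^[j] ((perturbedFamily p q μ)^[n + N + 1] x) := fun μ j => by
    rw [add_comm, Function.iterate_add_apply]
  have hnorm : ∀ μ, ‖μ - l₁‖ < (p : ℝ)⁻¹ ^ (N + 1) * ‖t‖ → ∀ j ≤ M + 1,
      ‖(perturbedFamily p q μ)^[n + N + 1 + j] x‖ = ‖(perturbedFamily p q l)^[j] t‖ :=
    fun μ hμ j hj => norm_eq_of_sub_lt (hshadow μ hμ j hj)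
  have hl₂l := hβ l₂ hl₂
  have hl₂1 := h.param_of H.prime hl₂l
  have hnear := H.near_one_of_approxFixedPoint hl₂1 ha1 haf.le hl₂a.le
  have hA : ∀ j ≤ M, ‖(perturbedFamily p q l₂)^[n + N + 1 + j] x‖ < 1 := fun j hj => by
    rw [hnorm l₂ hl₂ j (by omega)]
    exact ht j (by omega)
  have hB : ∀ j ≤ N, ‖(perturbedFamily p q l₂)^[n + j] x - 1‖ < 1 := fun j hj =>
    h.near_one_of H hl₂l hj
  refine ⟨l₂, hl₂l, ⟨hl₂1, ?_, ?_, ?_, ?_, ?_⟩, hB, hA⟩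
  · intro μ μ' hμ hμ'
    rcases eq_or_ne μ μ' with rfl | hne
    · simp
    have hσ : 0 < ‖μ - μ'‖ := norm_pos_iff.2 (sub_ne_zero.2 hne)
    have hσ' : ‖μ - μ'‖ < (p : ℝ)⁻¹ ^ (N + 4) :=
      norm_sub_lt_trans hμ (by rwa [norm_sub_rev])
    have hd : (p : ℝ) ^ (N + 1) * ‖μ - μ'‖ ≤ (p : ℝ)⁻¹ ^ 2 := by
      calc (p : ℝ) ^ (N + 1) * ‖μ - μ'‖ ≤ (p : ℝ) ^ (N + 1) * (p : ℝ)⁻¹ ^ (N + 4) := by gcongr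
        _ = (p : ℝ) ^ (N + 1) * (p : ℝ)⁻¹ ^ (N + 2) * (p : ℝ)⁻¹ ^ 2 := by ring
        _ ≤ (p : ℝ)⁻¹ ^ 2 :=
          mul_le_of_le_one_left (by positivity) (H.p_pow_mul_inv_pow (by omega))
    have hσ2 : ‖μ - μ'‖ ≤ (p : ℝ)⁻¹ ^ 2 :=
      hσ'.le.trans (pow_le_pow_of_le_one (by positivity) hinv.le (by omega))
    have hexp := h.expansion H (hβ _ (hball _ hμ)) (hβ _ (hball _ hμ')) (N + 1) le_rfl
    -- The spread `p ^ (N + 1) * ‖μ - μ'‖` at the exit is reduced by `k ^ M` below `‖μ - μ'‖`, so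
    -- the last step's direct dependence on the parameter dominates and gives the isometry.
    obtain ⟨-, h1, h2⟩ := H.norm_iterate_sub_le (l := μ)
      (z := (perturbedFamily p q μ)^[n + N + 1] x)
      (w := (perturbedFamily p q μ')^[n + N + 1] x) (M := M)
      (h.param_of H.prime (hβ _ (hball _ hμ')))
      (fun j hj => by
        rw [← hit, hnorm _ (hball _ hμ') j (by omega)]; exact ht j (by omega))
      (by rw [← hit, hnorm _ (hball _ hμ') _ le_rfl, htM1]) hd hσ2 hexp.le le_rfl
    rw [hit, hit, ← h1, ← sub_add_sub_cancel _
      (perturbedFamily p q μ' ((perturbedFamily p q μ)^[M]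
        ((perturbedFamily p q μ)^[n + N + 1] x))),
      norm_add_eq_left]
    rw [h1]
    refine h2.trans_lt (max_lt ?_ (mul_lt_of_lt_one_left hσ H.k_lt_one))
    rw [← mul_assoc]
    refine mul_lt_of_lt_one_left hσ ?_
    calc k ^ M * (p : ℝ) ^ (N + 1) ≤ (p : ℝ)⁻¹ ^ (N + 5) * (p : ℝ) ^ (N + 1) := by gcongr
      _ = (p : ℝ) ^ (N + 1) * (p : ℝ)⁻¹ ^ (N + 4) * (p : ℝ)⁻¹ := by ring
      _ ≤ (p : ℝ)⁻¹ := mul_le_of_le_one_left (by positivity) (H.p_pow_mul_inv_pow (by omega))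
      _ < 1 := hinv
  · intro μ hμ m hm
    rcases lt_or_ge m (n + N + 1) with hm' | hm'
    · rcases lt_or_ge m n with hmn | hmn
      · refine norm_sub_lt_trans (h.close μ (hβ _ (hball _ hμ)) m hmn.le) ?_
        rw [norm_sub_rev]
        exact h.close l₂ hl₂l m hmn.le
      · obtain ⟨j, rfl⟩ := Nat.exists_eq_add_of_le hmn
        refine norm_sub_lt_trans (h.near_one_of H (hβ _ (hball _ hμ)) (by omega)) ?_
        rw [norm_sub_rev]
        exact h.near_one_of H hl₂l (by omega)
    · obtain ⟨j, rfl⟩ := Nat.exists_eq_add_of_le hm'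
      have hj : j ≤ M + 1 := by omega
      have hle : ‖(perturbedFamily p q l)^[j] t‖ ≤ 1 := by
        rcases hj.eq_or_lt with rfl | hj
        · exact htM1.le
        · exact (ht j hj).le
      refine norm_sub_lt_trans ((hshadow μ (hball μ hμ) j hj).trans_le hle) ?_
      rw [norm_sub_rev]
      exact (hshadow l₂ hl₂ j hj).trans_le hle
  · intro m hm
    rcases lt_or_ge m (n + N + 1) with hm' | hm'
    · exact h.bounded_of H hl₂l hm'
    · obtain ⟨j, rfl⟩ := Nat.exists_eq_add_of_le hm'
      rcases (show j ≤ M + 1 by omega).eq_or_lt with rfl | hj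
      · rw [hnorm l₂ hl₂ _ le_rfl, htM1]
      · exact (hA j (by omega)).le
  · intro j hj
    rw [add_comm, Function.iterate_add_apply]
    exact hnear.1 j (by omega)
  · rw [add_assoc _ (N + 4) 1, add_comm, Function.iterate_add_apply]
    exact hnear.2

/-- Every parameter has points that land near `1` after one step and stay there for as long
as we please. -/
lemma exists_isLanding {l : K} (hl : ‖l - 1‖ < 1) (N : ℕ) : ∃ x, IsLanding p q x 1 N l := by
  have hp := H.p_pos
  have hinv := H.inv_p_lt_one
  obtain ⟨a, -, ha1, haf, -⟩ := H.exists_approxFixedPoint (S := {l}) hl (by simp)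
    (ε := (p : ℝ)⁻¹ ^ (N + 1)) (by positivity)
  replace ha1 := ha1 l rfl
  replace haf := haf l rfl
  have haN := norm_eq_one_of_sub_one_lt ha1
  obtain ⟨x, hx, hxa⟩ := H.exists_norm_apply_sub_lt hl haN.le (ε := (p : ℝ)⁻¹ ^ (N + 1))
    (by positivity)
  have hfx : ‖perturbedFamily p q l x‖ = 1 := by
    rw [← haN]
    refine norm_eq_of_sub_lt (hxa.trans_le ?_)
    rw [haN]
    exact H.inv_p_pow_le_one _
  have hnear := H.near_one_of_approxFixedPoint hl ha1 haf.le hxa.le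
  have hfx' := (H.norm_apply_eq hl hx (by rw [hfx]; exact H.s_lt_one)).2
  rw [hfx] at hfx'
  have h1x : ‖1 - x‖ = 1 := by
    rw [sub_eq_add_neg, norm_add_eq_left, norm_one]
    rwa [norm_neg, norm_one]
  -- Here `p * ‖x‖ ^ p = 1` and `‖1 - x‖ = 1`, so no scaling remains.
  have hiso : ∀ μ μ' : K, ‖perturbedFamily p q μ x - perturbedFamily p q μ' x‖ = ‖μ - μ'‖ := by
    intro μ μ'
    rw [H.norm_param_sub, h1x, mul_one, mul_right_comm, ← hfx', one_mul]
  refine ⟨x, hl, fun μ μ' _ _ => hiso μ μ', fun μ hμ m hm => ?_, fun m hm => ?_, fun j hj => ?_, ?_⟩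
  · interval_cases m
    · simp
    · rw [Function.iterate_one, Function.iterate_one, hiso]
      exact hμ.trans_le (H.inv_p_pow_le_one N)
  · interval_cases m
    · exact hx.le
    · exact hfx.le
  · rw [add_comm, Function.iterate_add_apply]
    exact hnear.1 j (by omega)
  · rw [add_assoc, add_comm, Function.iterate_add_apply]
    exact hnear.2

end IsSmallPerturbation

/-! ### The limit parameter and the discs that follow its itinerary -/

namespace IsSmallPerturbation

open Ultrametric Filter Topology

section sequence

variable {K : Type*} [NontriviallyNormedField K] [IsUltrametricDist K] [IsAlgClosed K]
  [CompleteSpace K] {p : ℕ} {q : K → K} {δ s k : ℝ} (H : IsSmallPerturbation p q δ s k)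

/-- The times at which the orbit arrives near `1`, when the `i`-th stay there has length
`N + 4 * i + 1` and the stay in the open unit disc after a stay of length `N + 1` near `1` has
length `M N + 1`. -/
def arrivalTime (M : ℕ → ℕ) (N : ℕ) : ℕ → ℕ
  | 0 => 1
  | i + 1 => arrivalTime M N i + (N + 4 * i) + 1 + (M (N + 4 * i) + 1)

lemma arrivalTime_mono (M : ℕ → ℕ) (N : ℕ) : StrictMono (arrivalTime M N) :=
  strictMono_nat_of_lt_succ fun i => by rw [arrivalTime]; omega

include H

/-- Arbitrarily close to every parameter there is a parameter having a point with an orbit which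
alternates between ever longer stays near `1` and in the open unit disc. -/
lemma exists_itinerary {l₀ : K} (hl₀ : ‖l₀ - 1‖ < 1) {M : ℕ → ℕ}
    (hM : ∀ N, k ^ M N ≤ (p : ℝ)⁻¹ ^ (N + 5)) (N : ℕ) :
    ∃ l x : K, ‖l - l₀‖ ≤ (p : ℝ)⁻¹ ^ N ∧ ‖l - 1‖ < 1 ∧ ‖x‖ ≤ 1 ∧
      ∀ i, (∀ j ≤ N + 4 * i, ‖(perturbedFamily p q l)^[arrivalTime M N i + j] x - 1‖ < 1) ∧
        ∀ j ≤ M (N + 4 * i),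
          ‖(perturbedFamily p q l)^[arrivalTime M N i + (N + 4 * i) + 1 + j] x‖ < 1 := by
  have hp := H.p_pos
  have hinv := H.inv_p_lt_one
  obtain ⟨x, hx⟩ := H.exists_isLanding hl₀ N
  have hstep : ∀ (i : ℕ) (l : K), IsLanding p q x (arrivalTime M N i) (N + 4 * i) l →
      ∃ l', ‖l' - l‖ < (p : ℝ)⁻¹ ^ (N + 4 * i)
        ∧ IsLanding p q x (arrivalTime M N (i + 1)) (N + 4 * (i + 1)) l'
        ∧ (∀ j ≤ N + 4 * i, ‖(perturbedFamily p q l')^[arrivalTime M N i + j] x - 1‖ < 1)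
        ∧ ∀ j ≤ M (N + 4 * i),
          ‖(perturbedFamily p q l')^[arrivalTime M N i + (N + 4 * i) + 1 + j] x‖ < 1 :=
    fun i l h => h.exists_next H (hM _)
  choose! g hg1 hg2 hg3 hg4 using hstep
  let L : ℕ → K := fun i => Nat.rec l₀ (fun i l => g i l) i
  have hL : ∀ i, IsLanding p q x (arrivalTime M N i) (N + 4 * i) (L i) := fun i => by
    induction i with
    | zero => exact hx
    | succ i ih => exact hg2 i _ ih
  have hdist : ∀ i, ‖L (i + 1) - L i‖ < (p : ℝ)⁻¹ ^ (N + 4 * i) := fun i => hg1 i _ (hL i)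
  have hcau : CauchySeq L := by
    refine cauchySeq_of_le_geometric (p : ℝ)⁻¹ 1 hinv fun i => ?_
    rw [dist_comm, dist_eq_norm, one_mul]
    exact (hdist i).le.trans (pow_le_pow_of_le_one (by positivity) hinv.le (by omega))
  obtain ⟨l, hl⟩ := cauchySeq_tendsto_of_complete hcau
  have hball : ∀ i m, ‖L (i + m) - L i‖ < (p : ℝ)⁻¹ ^ (N + 4 * i) := fun i m => by
    induction m with
    | zero => simpa using by positivity
    | succ m ih =>
      refine norm_sub_lt_trans ((hdist (i + m)).trans_le ?_) ih
      exact pow_le_pow_of_le_one (by positivity) hinv.le (by omega)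
  have hlim : ∀ i, ‖l - L i‖ < (p : ℝ)⁻¹ ^ (N + 4 * i) := fun i => by
    rw [← mem_ball_iff_norm]
    -- Open balls are closed, so the strict inequality survives the limit and `IsLanding` still
    -- applies at `l`.
    refine (IsUltrametricDist.isClosed_ball (L i) _).mem_of_tendsto hl ?_
    filter_upwards [eventually_ge_atTop i] with j hj
    obtain ⟨m, rfl⟩ := Nat.exists_eq_add_of_le hj
    exact mem_ball_iff_norm.2 (hball i m)
  refine ⟨l, x, (hlim 0).le, (hL 0).param_of H.prime (hlim 0), (hL 0).bounded 0 (by simp),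
    fun i => ⟨fun j hj => ?_, fun j hj => ?_⟩⟩
  · refine norm_sub_lt_trans ((hL (i + 1)).close l (hlim (i + 1)) _ ?_) (hg3 i _ (hL i) j hj)
    rw [arrivalTime]
    omega
  · have h1 := (hL (i + 1)).close l (hlim (i + 1)) (arrivalTime M N i + (N + 4 * i) + 1 + j) (by
      rw [arrivalTime]; omega)
    have := norm_add_lt h1 (hg4 i _ (hL i) j hj)
    rwa [sub_add_cancel] at this

omit [IsAlgClosed K] [CompleteSpace K] in
/-- All points close to a point with such an itinerary follow it closely. -/
lemma norm_iterate_sub_le_of_itinerary {l x : K} (hl : ‖l - 1‖ < 1) (hx : ‖x‖ ≤ 1) {M : ℕ → ℕ}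
    (hM : ∀ N, k ^ M N ≤ (p : ℝ)⁻¹ ^ (N + 5)) {N : ℕ}
    (hB : ∀ i, ∀ j ≤ N + 4 * i, ‖(perturbedFamily p q l)^[arrivalTime M N i + j] x - 1‖ < 1)
    (hA : ∀ i, ∀ j ≤ M (N + 4 * i),
      ‖(perturbedFamily p q l)^[arrivalTime M N i + (N + 4 * i) + 1 + j] x‖ < 1)
    {y : K} (hy : ‖y - x‖ ≤ (p : ℝ)⁻¹ ^ (N + 4)) (m : ℕ) :
    ‖(perturbedFamily p q l)^[m] y - (perturbedFamily p q l)^[m] x‖ < 1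
      ∧ ‖(perturbedFamily p q l)^[m] x‖ ≤ 1 := by
  have hp := H.p_pos
  have hinv := H.inv_p_lt_one
  have hk0 := H.k_pos
  set f := perturbedFamily p q l with hf
  have hlip : ∀ m c, ‖f^[m] x‖ ≤ 1 → ‖f^[m] y - f^[m] x‖ ≤ c → c ≤ 1 →
      ‖f^[m + 1] y - f^[m + 1] x‖ ≤ p * c := fun m c h1 h2 h3 => by
    have h4 := norm_add_le' (h2.trans h3) h1
    rw [sub_add_cancel] at h4
    rw [Function.iterate_succ_apply', Function.iterate_succ_apply']
    refine (H.norm_sub_le_mul hl h4 h1).trans ?_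
    gcongr
  have hpN : ∀ j N : ℕ, j ≤ N + 1 →
      (p : ℝ) ^ j * (p : ℝ)⁻¹ ^ (N + 3) ≤ (p : ℝ)⁻¹ ^ 2 := fun j N hj => by
    rw [show (p : ℝ) ^ j * (p : ℝ)⁻¹ ^ (N + 3)
      = (p : ℝ) ^ j * (p : ℝ)⁻¹ ^ (N + 1) * (p : ℝ)⁻¹ ^ 2 by ring]
    exact mul_le_of_le_one_left (by positivity) (H.p_pow_mul_inv_pow hj)
  have hp2 : (p : ℝ)⁻¹ ^ 2 < 1 := pow_lt_one₀ (by positivity) hinv two_ne_zero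
  have hstayB : ∀ i, ‖f^[arrivalTime M N i] y - f^[arrivalTime M N i] x‖
      ≤ (p : ℝ)⁻¹ ^ (N + 4 * i + 3) → ∀ j ≤ N + 4 * i + 1,
      ‖f^[arrivalTime M N i + j] y - f^[arrivalTime M N i + j] x‖
        ≤ p ^ j * (p : ℝ)⁻¹ ^ (N + 4 * i + 3) := fun i hi j => by
    induction j with
    | zero => intro _; simpa using hi
    | succ j ih =>
      intro hj
      have := hlip (arrivalTime M N i + j) _
        (norm_eq_one_of_sub_one_lt (hB i j (by omega))).le (ih (by omega))
        ((hpN _ _ (by omega)).trans hp2.le)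
      rwa [← mul_assoc, ← pow_succ'] at this
  have hit : ∀ (n j : ℕ) (z : K), f^[n + j] z = f^[j] (f^[n] z) := fun n j z => by
    rw [add_comm, Function.iterate_add_apply]
  have hstayA : ∀ i, ‖f^[arrivalTime M N i] y - f^[arrivalTime M N i] x‖
      ≤ (p : ℝ)⁻¹ ^ (N + 4 * i + 3) →
      (∀ j ≤ M (N + 4 * i), ‖f^[arrivalTime M N i + (N + 4 * i) + 1 + j] y
        - f^[arrivalTime M N i + (N + 4 * i) + 1 + j] x‖ ≤ (p : ℝ)⁻¹ ^ 2) ∧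
      ‖f^[arrivalTime M N (i + 1)] y - f^[arrivalTime M N (i + 1)] x‖
        ≤ (p : ℝ)⁻¹ ^ (N + 4 * (i + 1) + 3) := fun i hi => by
    have hd := (hstayB i hi _ le_rfl).trans (hpN _ _ le_rfl)
    rw [← add_assoc] at hd
    have h1 := H.norm_iterate_sub_le (l := l) (l' := l) (M := M (N + 4 * i)) (σ := 0) hl
      (z := f^[arrivalTime M N i + (N + 4 * i) + 1] y)
      (w := f^[arrivalTime M N i + (N + 4 * i) + 1] x)
      (fun j hj => by rw [← hf, ← hit]; exact hA i j hj)
      (by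
        rw [← hf, ← hit]
        exact norm_eq_one_of_sub_one_lt (hB (i + 1) 0 (Nat.zero_le _)))
      le_rfl (by positivity) hd (by simp)
    obtain ⟨h2, -, h3⟩ := h1
    rw [← hf] at h2 h3
    have hmax : ∀ j, max (k ^ j * (p : ℝ)⁻¹ ^ 2) (k * 0) = k ^ j * (p : ℝ)⁻¹ ^ 2 := fun j => by
      rw [mul_zero, max_eq_left (by positivity)]
    refine ⟨fun j hj => ?_, ?_⟩
    · rw [hit _ j, hit _ j]
      refine (h2 j hj).trans ?_
      rw [hmax]
      exact mul_le_of_le_one_left (by positivity) (pow_le_one₀ hk0.le H.k_lt_one.le)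
    · rw [arrivalTime, hit _ (M (N + 4 * i) + 1), hit _ (M (N + 4 * i) + 1)]
      rw [← Function.iterate_succ_apply' f, hmax] at h3
      refine h3.trans ?_
      calc k ^ M (N + 4 * i) * (p : ℝ)⁻¹ ^ 2
          ≤ (p : ℝ)⁻¹ ^ (N + 4 * i + 5) * (p : ℝ)⁻¹ ^ 2 := by gcongr; exact hM _
        _ = _ := by rw [← pow_add]; congr 1
  -- The first step costs one factor `p`. A cycle then costs at most `p ^ (N + 4 * i + 1)` and gains
  -- `k ^ M ≤ p⁻¹ ^ (N + 4 * i + 5)`: a net gain of four powers of `p`, matching the growth of the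
  -- stays.
  have harr : ∀ i, ‖f^[arrivalTime M N i] y - f^[arrivalTime M N i] x‖
      ≤ (p : ℝ)⁻¹ ^ (N + 4 * i + 3) := fun i => by
    induction i with
    | zero =>
      refine (hlip 0 _ hx hy (H.inv_p_pow_le_one _)).trans_eq ?_
      rw [pow_succ, mul_comm, mul_assoc, inv_mul_cancel₀ hp.ne', mul_one]
    | succ i ih => exact (hstayA i ih).2
  -- locate `m` in the itinerary
  rcases Nat.eq_zero_or_pos m with rfl | hm
  · refine ⟨hy.trans_lt ?_, hx⟩
    exact pow_lt_one₀ (by positivity) hinv (by omega)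
  obtain ⟨i, hi1, hi2⟩ : ∃ i, arrivalTime M N i ≤ m ∧ m < arrivalTime M N (i + 1) := by
    have hex : ∃ i, m < arrivalTime M N (i + 1) :=
      ⟨m, (Nat.lt_succ_self m).trans_le ((arrivalTime_mono M N).le_apply)⟩
    refine ⟨Nat.find hex, ?_, Nat.find_spec hex⟩
    rcases Nat.eq_zero_or_pos (Nat.find hex) with h0 | h0
    · rw [h0]; exact hm
    · have := Nat.find_min hex (Nat.sub_lt h0 one_pos)
      rwa [not_lt, show Nat.find hex - 1 + 1 = Nat.find hex by omega] at this
  obtain ⟨j, rfl⟩ := Nat.exists_eq_add_of_le hi1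
  rw [arrivalTime] at hi2
  rcases Nat.lt_or_ge j (N + 4 * i + 1) with hj | hj
  · exact ⟨((hstayB i (harr i) j hj.le).trans (hpN _ _ hj.le)).trans_lt hp2,
      (norm_eq_one_of_sub_one_lt (hB i j (by omega))).le⟩
  · obtain ⟨e, rfl⟩ := Nat.exists_eq_add_of_le hj
    rw [← add_assoc, ← add_assoc]
    exact ⟨((hstayA i (harr i)).1 e (by omega)).trans_lt hp2, (hA i e (by omega)).le⟩

end sequence

end IsSmallPerturbation

/-! ### Wandering and absence of attraction -/

section itinerary

open Filter Topology Ultrametric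

variable {K : Type*} [NormedField K] [IsUltrametricDist K]

/-- A sequence whose differences grow at a bounded rate, and which frequently moves far in `n`
steps, does not converge along any residue class modulo `n`. -/
lemma not_tendsto_of_frequently {w : ℕ → K} {c : ℝ} (hc : 1 ≤ c)
    (hw : ∀ a b, ‖w (a + 1) - w (b + 1)‖ ≤ c * ‖w a - w b‖) {n : ℕ}
    (hn : 0 < n) (hfar : ∀ m₀, ∃ m ≥ m₀, 1 ≤ ‖w (m + n) - w m‖) (j : ℕ) (z : K) :
    ¬ Tendsto (fun i => w (j + n * i)) atTop (𝓝 z) := by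
  intro hz
  have hc0 : 0 < c := by linarith
  have h1 : Tendsto (fun i => w (j + n * (i + 1)) - w (j + n * i)) atTop (𝓝 (z - z)) :=
    (hz.comp (tendsto_add_atTop_nat 1)).sub hz
  rw [sub_self] at h1
  -- Convergence makes `n`-step moves along the residue class smaller than `(c ^ n)⁻¹`; fewer than
  -- `n` further steps reach any later time and cannot raise this to 1.
  have h2 := h1.norm.eventually (gt_mem_nhds (show ‖(0 : K)‖ < (c ^ n)⁻¹ by
    rw [norm_zero]; positivity))
  obtain ⟨i₀, hi₀⟩ := eventually_atTop.1 h2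
  obtain ⟨m, hm, hm'⟩ := hfar (j + n * i₀)
  obtain ⟨e, rfl⟩ := Nat.exists_eq_add_of_le hm
  have hgrow : ∀ i a, ‖w (j + n * i + n + a) - w (j + n * i + a)‖
      ≤ c ^ a * ‖w (j + n * i + n) - w (j + n * i)‖ := fun i a => by
    induction a with
    | zero => simp
    | succ a ih =>
      refine (hw (j + n * i + n + a) (j + n * i + a)).trans ?_
      rw [pow_succ', mul_assoc]
      gcongr
  have hlt := hi₀ (i₀ + e / n) (Nat.le_add_right _ _)
  rw [mul_add, mul_one, ← add_assoc] at hlt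
  have h3 := hgrow (i₀ + e / n) (e % n)
  have hidx : j + n * (i₀ + e / n) + e % n = j + n * i₀ + e := by
    have := Nat.div_add_mod e n
    rw [mul_add]
    omega
  rw [show j + n * (i₀ + e / n) + n + e % n = j + n * i₀ + e + n by omega, hidx] at h3
  refine absurd (hm'.trans h3) (not_le.2 ?_)
  calc _ < c ^ (e % n) * (c ^ n)⁻¹ := by gcongr
    _ ≤ c ^ n * (c ^ n)⁻¹ := by
      gcongr
      exact (Nat.mod_lt _ hn).le
    _ = 1 := mul_inv_cancel₀ (by positivity)

end itinerary

namespace IsSmallPerturbation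

open Ultrametric Filter Topology

variable {K : Type*} [NontriviallyNormedField K] [IsUltrametricDist K] [IsAlgClosed K]
  [CompleteSpace K] {p : ℕ} {q : K → K} {δ s k : ℝ} (H : IsSmallPerturbation p q δ s k)

include H

/-- Near every parameter there is one with a wandering disc in the closed unit disc that is not
attracted to any cycle. -/
theorem exists_wanderingDisc {l₀ : K} (hl₀ : ‖l₀ - 1‖ < 1) {ε : ℝ} (hε : 0 < ε) :
    ∃ l : K, ‖l - l₀‖ < ε ∧ ‖l - 1‖ < 1 ∧ ∃ D : Set K, IsDisc D ∧
      (∀ y ∈ D, ∀ m, ‖(perturbedFamily p q l)^[m] y‖ ≤ 1) ∧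
      (∀ n m : ℕ, ((perturbedFamily p q l)^[n] '' D ∩ (perturbedFamily p q l)^[m] '' D).Nonempty →
        n = m) ∧
      ∀ (n : ℕ) (z : K), 0 < n → ∀ y ∈ D, ¬ IsAttractedTo (perturbedFamily p q l) n z y := by
  have hp := H.p_pos
  have hinv := H.inv_p_lt_one
  have hex : ∀ N : ℕ, ∃ M : ℕ, k ^ M ≤ (p : ℝ)⁻¹ ^ (N + 5) := fun N =>
    (exists_pow_lt_of_lt_one (pow_pos (inv_pos.2 hp) _) H.k_lt_one).imp fun _ h => h.le
  choose M hM using hex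
  obtain ⟨N, hN⟩ := exists_pow_lt_of_lt_one hε hinv
  obtain ⟨l, x, hll, hl, hx, hi⟩ := H.exists_itinerary hl₀ hM N
  refine ⟨l, hll.trans_lt hN, hl, Metric.ball x ‖(p : K) ^ (N + 4)‖,
    ⟨x, _, pow_ne_zero _ H.p_ne_zero, Or.inl rfl⟩, ?_⟩
  have hD : ∀ y ∈ Metric.ball x ‖(p : K) ^ (N + 4)‖, ∀ m,
      ‖(perturbedFamily p q l)^[m] y - (perturbedFamily p q l)^[m] x‖ < 1
        ∧ ‖(perturbedFamily p q l)^[m] x‖ ≤ 1 := fun y hy => by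
    rw [mem_ball_iff_norm, norm_pow, H.norm_p] at hy
    exact H.norm_iterate_sub_le_of_itinerary hl hx hM (fun i => (hi i).1) (fun i => (hi i).2) hy.le
  have hbdd : ∀ y ∈ Metric.ball x ‖(p : K) ^ (N + 4)‖, ∀ m,
      ‖(perturbedFamily p q l)^[m] y‖ ≤ 1 := fun y hy m => by
    have := norm_add_le' (hD y hy m).1.le (hD y hy m).2
    rwa [sub_add_cancel] at this
  have hB : ∀ y ∈ Metric.ball x ‖(p : K) ^ (N + 4)‖, ∀ i, ∀ j ≤ N + 4 * i,
      ‖(perturbedFamily p q l)^[arrivalTime M N i + j] y - 1‖ < 1 := fun y hy i j hj =>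
    norm_sub_lt_trans (hD y hy _).1 ((hi i).1 j hj)
  have hA : ∀ y ∈ Metric.ball x ‖(p : K) ^ (N + 4)‖, ∀ i,
      ‖(perturbedFamily p q l)^[arrivalTime M N i + (N + 4 * i) + 1] y‖ < 1 := fun y hy i => by
    have := norm_add_lt (hD y hy (arrivalTime M N i + (N + 4 * i) + 1)).1
      ((hi i).2 0 (Nat.zero_le _))
    rwa [add_zero, sub_add_cancel] at this
  have hseparate : ∀ d > 0, ∀ m₀, ∃ m ≥ m₀, ∀ y ∈ Metric.ball x ‖(p : K) ^ (N + 4)‖,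
      ∀ y' ∈ Metric.ball x ‖(p : K) ^ (N + 4)‖,
      ‖(perturbedFamily p q l)^[m + d] y - (perturbedFamily p q l)^[m] y'‖ = 1 := by
    intro d hd m₀
    have hle := (arrivalTime_mono M N).le_apply (x := m₀ + d)
    -- The time `d` steps before the exit from the stay number `m₀ + d`, which lasts longer than
    -- `d`: the orbit is near 1 then, and in the open unit disc `d` steps later.
    refine ⟨arrivalTime M N (m₀ + d) + (N + 4 * (m₀ + d) + 1 - d), by omega, fun y hy y' hy' => ?_⟩
    have h1 := hA y hy (m₀ + d)
    have h2 := hB y' hy' (m₀ + d) (N + 4 * (m₀ + d) + 1 - d) (by omega)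
    have h3 := norm_eq_one_of_sub_one_lt h2
    rw [show arrivalTime M N (m₀ + d) + (N + 4 * (m₀ + d) + 1 - d) + d
      = arrivalTime M N (m₀ + d) + (N + 4 * (m₀ + d)) + 1 by omega, norm_sub_rev, sub_eq_add_neg,
      norm_add_eq_left, h3]
    rwa [norm_neg, h3]
  refine ⟨hbdd, ?_, ?_⟩
  · have key : ∀ n d, 0 < d → ∀ y ∈ Metric.ball x ‖(p : K) ^ (N + 4)‖,
        ∀ y' ∈ Metric.ball x ‖(p : K) ^ (N + 4)‖,
        (perturbedFamily p q l)^[n + d] y ≠ (perturbedFamily p q l)^[n] y' := by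
      intro n d hd y hy y' hy' heq
      obtain ⟨m, hm, hm'⟩ := hseparate d hd n
      obtain ⟨e, rfl⟩ := Nat.exists_eq_add_of_le hm
      have h1 := hm' y hy y' hy'
      -- A coincidence would persist under `e` further iterations, up to a time at which the two
      -- points are at distance 1.
      rw [show n + e + d = e + (n + d) by omega, show n + e = e + n by omega,
        Function.iterate_add_apply, heq, Function.iterate_add_apply _ e n, sub_self,
        norm_zero] at h1
      exact zero_ne_one h1
    rintro n m ⟨_, ⟨y, hy, rfl⟩, y', hy', heq⟩
    rcases lt_trichotomy n m with h | h | h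
    · obtain ⟨d, rfl⟩ := Nat.exists_eq_add_of_le h.le
      exact absurd heq (key n d (by omega) y' hy' y hy)
    · exact h
    · obtain ⟨d, rfl⟩ := Nat.exists_eq_add_of_le h.le
      exact absurd heq.symm (key m d (by omega) y hy y' hy')
  · rintro n z hn y hy ⟨j, hj⟩
    refine not_tendsto_of_frequently (w := fun m => (perturbedFamily p q l)^[m] y)
      H.one_lt_p.le (fun a b => ?_) hn (fun m₀ => ?_) j z hj
    · simp only [Function.iterate_succ_apply']
      exact H.norm_sub_le_mul hl (hbdd y hy a) (hbdd y hy b)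
    · obtain ⟨m, hm, hm'⟩ := hseparate n hn m₀
      exact ⟨m, hm, (hm' y hy y hy).ge⟩

end IsSmallPerturbation

/-! ### Power series as small perturbations, and the theorem -/

open Filter Topology Ultrametric

section series

variable {p : ℕ} [Fact p.Prime] {r : ℝ} {Q : ℂ_[p]⟦X⟧}

/-- Convergence at a point of norm exactly `r` makes the terms tend to zero; without boundedness the
real supremum would take its default value 0 and bound nothing. -/
lemma bddAbove_coeff_mul_pow (hr_val : ∃ u : ℂ_[p], ‖u‖ = r) (hQ : IsHolomorphicOnDisc p r Q) :
    BddAbove (Set.range fun i : ℕ => ‖PowerSeries.coeff i Q‖ * r ^ i) := by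
  obtain ⟨u, rfl⟩ := hr_val
  have h := (hQ u (le_refl ‖u‖)).tendsto_atTop_zero.norm
  simp only [norm_mul, norm_pow] at h
  exact h.bddAbove_range

lemma norm_coeff_mul_pow_le (hr_val : ∃ u : ℂ_[p], ‖u‖ = r) (hQ : IsHolomorphicOnDisc p r Q)
    (i : ℕ) : ‖PowerSeries.coeff i Q‖ * r ^ i ≤ discNorm p r Q :=
  le_ciSup (bddAbove_coeff_mul_pow hr_val hQ) i

lemma discNorm_nonneg (hr : 1 < r) : 0 ≤ discNorm p r Q :=
  Real.iSup_nonneg fun _ => by positivity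

lemma norm_coeff_le (hr : 1 < r) (hr_val : ∃ u : ℂ_[p], ‖u‖ = r) (hQ : IsHolomorphicOnDisc p r Q)
    (i : ℕ) : ‖PowerSeries.coeff i Q‖ ≤ discNorm p r Q :=
  (le_mul_of_one_le_right (norm_nonneg _) (one_le_pow₀ hr.le)).trans
    (norm_coeff_mul_pow_le hr_val hQ i)

lemma summable_of_norm_le_one (hr : 1 < r) (hQ : IsHolomorphicOnDisc p r Q) {z : ℂ_[p]}
    (hz : ‖z‖ ≤ 1) : Summable fun n : ℕ => PowerSeries.coeff n Q * z ^ n :=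
  hQ z (hz.trans hr.le)

lemma norm_evalSeries_le (hr : 1 < r) (hr_val : ∃ u : ℂ_[p], ‖u‖ = r)
    (hQ : IsHolomorphicOnDisc p r Q) {z : ℂ_[p]} (hz : ‖z‖ ≤ 1) :
    ‖evalSeries p Q z‖ ≤ discNorm p r Q := by
  refine IsUltrametricDist.norm_tsum_le_of_forall_le_of_nonneg (discNorm_nonneg hr) fun i => ?_
  rw [norm_mul, norm_pow]
  exact (mul_le_of_le_one_right (norm_nonneg _) (pow_le_one₀ (norm_nonneg _) hz)).trans
    (norm_coeff_le hr hr_val hQ i)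

lemma norm_evalSeries_sub_le (hr : 1 < r) (hr_val : ∃ u : ℂ_[p], ‖u‖ = r)
    (hQ : IsHolomorphicOnDisc p r Q) {z w : ℂ_[p]} (hz : ‖z‖ ≤ 1) (hw : ‖w‖ ≤ 1) :
    ‖evalSeries p Q z - evalSeries p Q w‖ ≤ discNorm p r Q * ‖z - w‖ := by
  have h0 : 0 ≤ discNorm p r Q := discNorm_nonneg hr
  rw [evalSeries, evalSeries, ← (summable_of_norm_le_one hr hQ hz).tsum_sub
    (summable_of_norm_le_one hr hQ hw)]
  refine IsUltrametricDist.norm_tsum_le_of_forall_le_of_nonneg (by positivity) fun i => ?_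
  rw [← mul_sub, norm_mul]
  have h := norm_coeff_le hr hr_val hQ i
  gcongr
  cases i with
  | zero => simp
  | succ i => simpa using norm_pow_sub_pow_le hz hw i

lemma uniformlyPolynomial_evalSeries (hr : 1 < r)
    (hQ : IsHolomorphicOnDisc p r Q) :
    UniformlyPolynomial (Metric.closedBall 0 1) (evalSeries p Q) := by
  intro ε hε
  have h1 : Tendsto (fun i : ℕ => ‖PowerSeries.coeff i Q‖) atTop (𝓝 0) := by
    have := (hQ 1 (by simpa [closedDisc] using hr.le)).tendsto_atTop_zero.norm
    simpa using this
  obtain ⟨n, hn⟩ := eventually_atTop.1 (h1.eventually (gt_mem_nhds (half_pos hε)))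
  refine ⟨∑ i ∈ Finset.range n, Polynomial.monomial i (PowerSeries.coeff i Q), fun z hz => ?_⟩
  have hz1 : ‖z‖ ≤ 1 := by simpa using hz
  have hs := summable_of_norm_le_one hr hQ hz1
  simp only [Polynomial.eval_finsetSum, Polynomial.eval_monomial]
  rw [evalSeries, ← hs.sum_add_tsum_nat_add n, add_sub_cancel_left]
  refine (IsUltrametricDist.norm_tsum_le_of_forall_le_of_nonneg (half_pos hε).le
    fun i => ?_).trans_lt (half_lt_self hε)
  rw [norm_mul, norm_pow]
  exact (mul_le_of_le_one_right (norm_nonneg _) (pow_le_one₀ (norm_nonneg _) hz1)).trans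
    (hn (i + n) (Nat.le_add_left _ _)).le

lemma isSmallPerturbation_evalSeries (hr : 1 < r) (hr_val : ∃ u : ℂ_[p], ‖u‖ = r)
    (hQ : IsHolomorphicOnDisc p r Q)
    (hQ_norm : discNorm p r Q < (p : ℝ) ^ (-1 / ((p : ℝ) - 1))) :
    IsSmallPerturbation p (evalSeries p Q) (discNorm p r Q) ((p : ℝ) ^ (-1 / ((p : ℝ) - 1)))
      ((p : ℝ) ^ (-1 / (p : ℝ))) := by
  have hpp : p.Prime := Fact.out
  have hp1 : (1 : ℝ) < p := by exact_mod_cast hpp.one_lt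
  have hp0 : (0 : ℝ) < p := by linarith
  refine ⟨hpp, ?_, by positivity, ?_, by positivity, ?_, hQ_norm,
    fun z hz => norm_evalSeries_le hr hr_val hQ hz,
    fun z w hz hw => norm_evalSeries_sub_le hr hr_val hQ hz hw,
    uniformlyPolynomial_evalSeries hr hQ⟩
  · have := PadicComplex.norm_extends' p (p : ℚ_[p])
    rw [Padic.norm_p] at this
    simpa using this
  · rw [← Real.rpow_natCast, ← Real.rpow_mul hp0.le, Nat.cast_sub hpp.one_le, Nat.cast_one,
      div_mul_cancel₀ _ (by linarith), Real.rpow_neg_one, mul_inv_cancel₀ hp0.ne']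
  · rw [← Real.rpow_natCast, ← Real.rpow_mul hp0.le, div_mul_cancel₀ _ hp0.ne', Real.rpow_neg_one,
      mul_inv_cancel₀ hp0.ne']

end series

theorem theorem3p1 (p : ℕ) [Fact p.Prime] (r : ℝ) (hr : 1 < r)
    (hr_val : ∃ u : ℂ_[p], ‖u‖ = r) (Q : ℂ_[p]⟦X⟧) (hQ : IsHolomorphicOnDisc p r Q)
    (hQ_norm : discNorm p r Q < (p : ℝ) ^ (-1 / ((p : ℝ) - 1))) :
    Dense {l : paramDisc p | ∃ D : Set ℂ_[p],
      IsNonattractedWanderingDisc (perturbedMap p Q (l : ℂ_[p])) (closedDisc p r) D} := by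
  have H := isSmallPerturbation_evalSeries hr hr_val hQ hQ_norm
  have hmap (l : ℂ_[p]) : perturbedMap p Q l = perturbedFamily p (evalSeries p Q) l := rfl
  rw [Metric.dense_iff]
  rintro ⟨l₀, hl₀⟩ ε hε
  obtain ⟨l, hll, hl, D, hD, hbdd, hwand, hattr⟩ := H.exists_wanderingDisc hl₀ hε
  -- The orbits never leave the closed unit disc, which lies in `B` because `r > 1`.
  have hJ : D ⊆ filledJulia (perturbedMap p Q l) (closedDisc p r) := fun y hy m =>
    (hbdd y hy m).trans hr.le
  refine ⟨⟨l, hl⟩, ?_, D, hD, hJ, ⟨fun y hy => hJ hy 0, hwand⟩, fun n z hz y hy =>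
    hattr n z hz.1 y hy⟩
  rw [Metric.mem_ball, Subtype.dist_eq, dist_eq_norm]
  exact hll
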